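/- **Setting.** A string diagram of type $m\to n$ over a signature is a term built from the operations of the signature, identities and symmetries by sequential composition $;$ (left to right) and parallel composition $\oplus$ (top to bottom), with the laws of symmetric strict monoidal categories (objects are natural numbers, $\oplus$ is addition on objects). Graphical Quadratic Algebra (GQA) has the generators copy $\Delta:1\to2$ (black comultiplication), discard $\epsilon:1\to0$ (black counit), addition $\mu:2\to1$ (white multiplication), zero $0:0\to1$ (white unit), scalars $k:1\to1$ for $k\in\mathbb R$, the constant one $\mathbf 1:0\to1$, the quadratic generator $g:0\to1$ (interpreted as $\mathcal N(0,1)$, or as the cost $\tfrac12x^2$), and the mirrored generators $\nabla:2\to1$ (black multiplication), $u:0\to1$ (black unit), $\nu:1\to2$ (white comultiplication), $z:1\to0$ (white counit, conditioning on being zero). Write $\mathrm{id}$ for one wire, $\sigma$ for the crossing of two wires, $\sigma'=\mathrm{id}\oplus\sigma\oplus\mathrm{id}$, $\cap=\nabla;\epsilon$, $\cup=u;\Delta$, $k^{\dagger}=(\cup\oplus\mathrm{id});(\mathrm{id}\oplus k\oplus\mathrm{id});(\mathrm{id}\oplus\cap)$ and $g^{\dagger}=(g\oplus\mathrm{id});\cap$.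 The axioms of GQA are the following. (Affine) $\mu$ is associative and commutative with unit $0$; $\Delta$ is coassociative and cocommutative with counit $\epsilon$; $\mathbf 1;\Delta=\mathbf 1\oplus\mathbf 1$; $\mathbf 1;\epsilon$ is the empty diagram; $\mu;k=(k\oplus k);\mu$; $0;k=0$; $k;\Delta=\Delta;(k\oplus k)$; $k;\epsilon=\epsilon$; $k;l$ is the scalar $kl$; $\Delta;(k\oplus l);\mu$ is the scalar $k+l$; the scalar $0$ is $\epsilon$ followed by the white unit; the scalar $1$ is $\mathrm{id}$; $\mu;\Delta=(\Delta\oplus\Delta);\sigma';(\mu\oplus\mu)$; $0;\Delta=0\oplus0$; $0;\epsilon$ is empty; $\mu;\epsilon=\epsilon\oplus\epsilon$. (Quadratic) $g;\epsilon$ and $g;z$ are empty; for every $\varphi\in[0,2\pi)$, $(g\oplus g);R_\varphi=g\oplus g$, where $R_\varphi:2\to2$ is the diagram of the rotation matrix $\begin{pmatrix}\cos\varphi&-\sin\varphi\\ \sin\varphi&\cos\varphi\end{pmatrix}$, i.e. $(\Delta\oplus\Delta);(\cos\varphi\oplus\sin\varphi\oplus(-\sin\varphi)\oplus\cos\varphi);\sigma';(\mu\oplus\mu)$.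 (Relational) the Frobenius laws $(\Delta\oplus\mathrm{id});(\mathrm{id}\oplus\nabla)=\nabla;\Delta=(\mathrm{id}\oplus\Delta);(\nabla\oplus\mathrm{id})$ and $(\nu\oplus\mathrm{id});(\mathrm{id}\oplus\mu)=\mu;\nu=(\mathrm{id}\oplus\nu);(\mu\oplus\mathrm{id})$; $\Delta;\nabla=\mathrm{id}=\nu;\mu$; $u;\epsilon$ and $0;z$ are empty; $\mu;z=(\mathrm{id}\oplus(-1));\cap$; $(\mathbf 1;z)\oplus\mathrm{id}=(\mathbf 1;z)\oplus(\epsilon;u)$; and $r;r^{\dagger}=\mathrm{id}=r^{\dagger};r$ for $r\ne0$. An equation between diagrams is derivable in GQA if it follows from these axioms and the laws of symmetric strict monoidal categories by equational (congruence) reasoning. **Theorem.** Let $n\ge0$ and let $M:0\to n$ be a string diagram of GQA. Then there are a string diagram $M':0\to n$ of the fragment $\overrightarrow{\mathrm{GQA}}_E$, i.e. one built only from the generators $\Delta,\epsilon,\mu,0,k\ (k\in\mathbb R),\mathbf 1,g$ of causal GQA and the black unit $u$ (so without $\nabla,\nu,z$), and a scalar diagram $\alpha:0\to0$, such that $$M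 = M'\oplus\alpha$$ is derivable in GQA, where $\alpha$ is either $\mathbf 1;c;g^{\dagger}$ for some $c\in[0,\infty)$ (the scalar with value $\tfrac12c^2$) or $\mathbf 1;z$ (the scalar with value $\infty$). -/

import Mathlib

namespace GQA

/-- A (monoidal) signature: `S m n` is the type of operations of arity `m` and coarity `n`. -/
abbrev Signature := ℕ → ℕ → Type

/-- `Σ`-terms of type `m → n`. Identities and symmetries are available on all numbers of wires,
`id 0` is the empty diagram. -/
inductive Term (S : Signature) : ℕ → ℕ → Type
  | gen {m n : ℕ} (s : S m n) : Term S m n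
  | id (n : ℕ) : Term S n n
  | swap (m n : ℕ) : Term S (m + n) (n + m)
  | comp {m n p : ℕ} (f : Term S m n) (g : Term S n p) : Term S m p
  | tensor {m n p q : ℕ} (f : Term S m n) (g : Term S p q) : Term S (m + p) (n + q)

/-- Sequential composition, in diagrammatic order (first the left diagram, then the right one). -/
infixl:65 " ⨾ " => Term.comp

/-- Parallel composition (the left diagram is drawn above the right one). -/
infixl:75 " ⊕ₚ " => Term.tensor

/-- Transport of a term along equalities of its arity and coarity. -/
def Term.cast {S : Signature} {m n m' n' : ℕ} (hm : m = m') (hn : n = n') (f : Term S m n) :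
    Term S m' n' :=
  hm ▸ hn ▸ f

/-- `f.UsesOnly P`: all operations that occur in the term `f` satisfy `P`. -/
def Term.UsesOnly {S : Signature} (P : ∀ ⦃m n : ℕ⦄, S m n → Prop) :
    {m n : ℕ} → Term S m n → Prop
  | _, _, .gen s => P s
  | _, _, .id _ => True
  | _, _, .swap _ _ => True
  | _, _, .comp f g => f.UsesOnly P ∧ g.UsesOnly P
  | _, _, .tensor f g => f.UsesOnly P ∧ g.UsesOnly P

/-- `Derivable E f g`: the equation `f = g` is derivable from the equations `E` and the laws of
symmetric strict monoidal categories, i.e. `f` and `g` are equal in the prop freely generated by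
`(S, E)`. It is the least congruence that contains `E` and these laws. -/
inductive Derivable {S : Signature} (E : ∀ ⦃m n : ℕ⦄, Term S m n → Term S m n → Prop) :
    ∀ {m n : ℕ}, Term S m n → Term S m n → Prop
  | ax {m n : ℕ} {f g : Term S m n} (h : E f g) : Derivable E f g
  -- congruence
  | refl {m n : ℕ} (f : Term S m n) : Derivable E f f
  | symm {m n : ℕ} {f g : Term S m n} (h : Derivable E f g) : Derivable E g f
  | trans {m n : ℕ} {f g h : Term S m n} (h₁ : Derivable E f g) (h₂ : Derivable E g h) :
      Derivable E f h
  | comp_congr {m n p : ℕ} {f f' : Term S m n} {g g' : Term S n p}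
      (h₁ : Derivable E f f') (h₂ : Derivable E g g') : Derivable E (f ⨾ g) (f' ⨾ g')
  | tensor_congr {m n p q : ℕ} {f f' : Term S m n} {g g' : Term S p q}
      (h₁ : Derivable E f f') (h₂ : Derivable E g g') : Derivable E (f ⊕ₚ g) (f' ⊕ₚ g')
  -- category
  | comp_assoc {m n p q : ℕ} (f : Term S m n) (g : Term S n p) (h : Term S p q) :
      Derivable E (f ⨾ g ⨾ h) (f ⨾ (g ⨾ h))
  | id_comp {m n : ℕ} (f : Term S m n) : Derivable E (.id m ⨾ f) f
  | comp_id {m n : ℕ} (f : Term S m n) : Derivable E (f ⨾ .id n) f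
  -- strict monoidal structure
  | tensor_assoc {m n p q r s : ℕ} (f : Term S m n) (g : Term S p q) (h : Term S r s) :
      Derivable E ((f ⊕ₚ g ⊕ₚ h).cast (Nat.add_assoc m p r) (Nat.add_assoc n q s))
        (f ⊕ₚ (g ⊕ₚ h))
  | empty_tensor {m n : ℕ} (f : Term S m n) :
      Derivable E ((.id 0 ⊕ₚ f).cast (Nat.zero_add m) (Nat.zero_add n)) f
  | tensor_empty {m n : ℕ} (f : Term S m n) :
      Derivable E ((f ⊕ₚ .id 0).cast (Nat.add_zero m) (Nat.add_zero n)) f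
  | id_tensor_id (m n : ℕ) : Derivable E (.id m ⊕ₚ .id n) (.id (m + n))
  | interchange {m n p m' n' p' : ℕ} (f : Term S m n) (g : Term S n p)
      (f' : Term S m' n') (g' : Term S n' p') :
      Derivable E ((f ⨾ g) ⊕ₚ (f' ⨾ g')) (f ⊕ₚ f' ⨾ g ⊕ₚ g')
  -- symmetry
  | swap_natural {m n p q : ℕ} (f : Term S m n) (g : Term S p q) :
      Derivable E (f ⊕ₚ g ⨾ .swap n q) (.swap m p ⨾ g ⊕ₚ f)
  | swap_swap (m n : ℕ) : Derivable E (.swap m n ⨾ .swap n m) (.id (m + n))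
  | swap_add (m n p : ℕ) :
      Derivable E (.swap m (n + p))
        ((.swap m n ⊕ₚ .id p : Term S (m + n + p) (n + m + p)).cast
            (Nat.add_assoc m n p) (Nat.add_assoc n m p) ⨾
          (.id n ⊕ₚ .swap m p : Term S (n + (m + p)) (n + (p + m))).cast
            rfl (Nat.add_assoc n p m).symm)

/-- The generators of Graphical Quadratic Algebra. -/
inductive Gen : Signature
  /-- black comultiplication (copying) -/
  | copy : Gen 1 2
  /-- black counit (discarding) -/
  | discard : Gen 1 0
  /-- white multiplication (addition) -/
  | add : Gen 2 1
  /-- white unit (the constant zero) -/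
  | zero : Gen 0 1
  /-- multiplication by a real number -/
  | scalar (k : ℝ) : Gen 1 1
  /-- the constant one -/
  | one : Gen 0 1
  /-- the quadratic generator (standard normal distribution, cost `x ^ 2 / 2`) -/
  | gauss : Gen 0 1
  /-- black multiplication -/
  | bmul : Gen 2 1
  /-- black unit -/
  | bunit : Gen 0 1
  /-- white comultiplication -/
  | wcomul : Gen 1 2
  /-- white counit (conditioning on being zero) -/
  | wcounit : Gen 1 0

/-- String diagrams of Graphical Quadratic Algebra. -/
abbrev Diagram (m n : ℕ) := Term Gen m n

/-- The generators of causal GQA, and the black unit. -/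
def Gen.IsCausalE : ⦃m n : ℕ⦄ → Gen m n → Prop
  | _, _, .copy => True
  | _, _, .discard => True
  | _, _, .add => True
  | _, _, .zero => True
  | _, _, .scalar _ => True
  | _, _, .one => True
  | _, _, .gauss => True
  | _, _, .bunit => True
  | _, _, .bmul => False
  | _, _, .wcomul => False
  | _, _, .wcounit => False

namespace Diagram

abbrev empty : Diagram 0 0 := .id 0
abbrev wire : Diagram 1 1 := .id 1
/-- the crossing of two wires -/
abbrev cross : Diagram 2 2 := .swap 1 1
abbrev copy : Diagram 1 2 := .gen .copy
abbrev discard : Diagram 1 0 := .gen .discard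
abbrev add : Diagram 2 1 := .gen .add
abbrev zero : Diagram 0 1 := .gen .zero
abbrev scalar (k : ℝ) : Diagram 1 1 := .gen (.scalar k)
abbrev one : Diagram 0 1 := .gen .one
abbrev gauss : Diagram 0 1 := .gen .gauss
abbrev bmul : Diagram 2 1 := .gen .bmul
abbrev bunit : Diagram 0 1 := .gen .bunit
abbrev wcomul : Diagram 1 2 := .gen .wcomul
abbrev wcounit : Diagram 1 0 := .gen .wcounit

/-- Four wires, of which the two in the middle cross. -/
abbrev middleCross : Diagram 4 4 := (wire ⊕ₚ cross ⊕ₚ wire : Diagram (1 + 2 + 1) (1 + 2 + 1))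

/-- Bending of wires with the black Frobenius structure, from the left. -/
def blackCup : Diagram 0 2 := bunit ⨾ copy

/-- Bending of wires with the black Frobenius structure, to the left. -/
def blackCap : Diagram 2 0 := bmul ⨾ discard

/-- The mirror image of `scalar k`. -/
def coscalar (k : ℝ) : Diagram 1 1 :=
  (blackCup ⊕ₚ wire : Diagram 1 3) ⨾ (wire ⊕ₚ scalar k ⊕ₚ wire) ⨾ (wire ⊕ₚ blackCap)

/-- The mirror image of `gauss`. -/
def cogauss : Diagram 1 0 := (gauss ⊕ₚ wire : Diagram 1 2) ⨾ blackCap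

/-- The diagram of the matrix `!![a, b; c, d]`, that is, of the map
`(x₁, x₂) ↦ (a * x₁ + b * x₂, c * x₁ + d * x₂)`. -/
def matrix₂ (a b c d : ℝ) : Diagram 2 2 :=
  copy ⊕ₚ copy ⨾ scalar a ⊕ₚ scalar c ⊕ₚ (scalar b ⊕ₚ scalar d) ⨾
    middleCross ⨾ add ⊕ₚ add

/-- The scalar with value `c ^ 2 / 2`: the cost that `gauss` assigns to the constant `c`. -/
def cost (c : ℝ) : Diagram 0 0 := one ⨾ scalar c ⨾ cogauss

/-- The scalar with value `∞`: the impossible condition `1 = 0`. -/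
def infinity : Diagram 0 0 := one ⨾ wcounit

/-- `α` is one of the scalars `cost c` with `0 ≤ c < ∞`, or `infinity`. -/
def IsNormalScalar (α : Diagram 0 0) : Prop :=
  (∃ c : ℝ, 0 ≤ c ∧ α = cost c) ∨ α = infinity

/-- `M` is a diagram of the fragment of GQA generated by causal GQA and the black unit. -/
def InCausalE {m n : ℕ} (M : Diagram m n) : Prop := M.UsesOnly Gen.IsCausalE

end Diagram

open Diagram in
/-- The axioms of Graphical Quadratic Algebra. -/
inductive Axioms : ∀ ⦃m n : ℕ⦄, Diagram m n → Diagram m n → Prop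
  -- affine fragment
  | add_assoc :
      Axioms ((add ⊕ₚ wire : Diagram 3 2) ⨾ add) ((wire ⊕ₚ add : Diagram 3 2) ⨾ add)
  | add_comm : Axioms (cross ⨾ add) add
  | zero_add : Axioms ((zero ⊕ₚ wire : Diagram 1 2) ⨾ add) wire
  | one_copy : Axioms (one ⨾ copy) (one ⊕ₚ one)
  | copy_assoc :
      Axioms (copy ⨾ (copy ⊕ₚ wire : Diagram 2 3)) (copy ⨾ (wire ⊕ₚ copy : Diagram 2 3))
  | copy_comm : Axioms (copy ⨾ cross) copy
  | copy_discard : Axioms (copy ⨾ (discard ⊕ₚ wire : Diagram 2 1)) wire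
  | one_discard : Axioms (one ⨾ discard) empty
  | add_scalar (k : ℝ) : Axioms (add ⨾ scalar k) (scalar k ⊕ₚ scalar k ⨾ add)
  | zero_scalar (k : ℝ) : Axioms (zero ⨾ scalar k) zero
  | scalar_copy (k : ℝ) : Axioms (scalar k ⨾ copy) (copy ⨾ scalar k ⊕ₚ scalar k)
  | scalar_discard (k : ℝ) : Axioms (scalar k ⨾ discard) discard
  | scalar_mul (k l : ℝ) : Axioms (scalar k ⨾ scalar l) (scalar (k * l))
  | scalar_add (k l : ℝ) : Axioms (copy ⨾ scalar k ⊕ₚ scalar l ⨾ add) (scalar (k + l))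
  | scalar_zero : Axioms (scalar 0) (discard ⨾ zero)
  | scalar_one : Axioms (scalar 1) wire
  | add_copy : Axioms (add ⨾ copy) (copy ⊕ₚ copy ⨾ middleCross ⨾ add ⊕ₚ add)
  | zero_copy : Axioms (zero ⨾ copy) (zero ⊕ₚ zero)
  | zero_discard : Axioms (zero ⨾ discard) empty
  | add_discard : Axioms (add ⨾ discard) (discard ⊕ₚ discard)
  -- quadratic fragment
  | gauss_discard : Axioms (gauss ⨾ discard) empty
  | gauss_zero : Axioms (gauss ⨾ wcounit) empty
  | gauss_rotation (φ : ℝ) (h₀ : 0 ≤ φ) (h₁ : φ < 2 * Real.pi) :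
      Axioms (gauss ⊕ₚ gauss ⨾ matrix₂ (Real.cos φ) (-Real.sin φ) (Real.sin φ) (Real.cos φ))
        (gauss ⊕ₚ gauss)
  -- relational fragment
  | black_frobenius_left :
      Axioms ((copy ⊕ₚ wire : Diagram 2 3) ⨾ (wire ⊕ₚ bmul : Diagram 3 2)) (bmul ⨾ copy)
  | black_frobenius_right :
      Axioms (bmul ⨾ copy) ((wire ⊕ₚ copy : Diagram 2 3) ⨾ (bmul ⊕ₚ wire : Diagram 3 2))
  | black_special : Axioms (copy ⨾ bmul) wire
  | black_bone : Axioms (bunit ⨾ discard) empty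
  | white_frobenius_left :
      Axioms ((wcomul ⊕ₚ wire : Diagram 2 3) ⨾ (wire ⊕ₚ add : Diagram 3 2)) (add ⨾ wcomul)
  | white_frobenius_right :
      Axioms (add ⨾ wcomul) ((wire ⊕ₚ wcomul : Diagram 2 3) ⨾ (add ⊕ₚ wire : Diagram 3 2))
  | white_special : Axioms (wcomul ⨾ add) wire
  | white_bone : Axioms (zero ⨾ wcounit) empty
  | white_cap : Axioms (add ⨾ wcounit) (wire ⊕ₚ scalar (-1) ⨾ blackCap)
  | infinity_disconnect : Axioms (infinity ⊕ₚ wire) (infinity ⊕ₚ (discard ⨾ bunit))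
  | scalar_coscalar (r : ℝ) (hr : r ≠ 0) : Axioms (scalar r ⨾ coscalar r) wire
  | coscalar_scalar (r : ℝ) (hr : r ≠ 0) : Axioms (coscalar r ⨾ scalar r) wire

/-- Equality of diagrams in the prop GQA, i.e. derivability from the axioms of GQA. -/
def Provable {m n : ℕ} (f g : Diagram m n) : Prop := Derivable Axioms f g

end GQA

/-!
Diagrams up to provable equality form a prop, whose morphisms are denoted by `Mor m n`. Call a
parallel composite of copies of `gauss` and `bunit` a source. The proof shows that every morphism
`0 → n` has the form `α ≫ S ≫ A`, where `α` is a scalar, `S` is a source and `A` is affine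
(`hasNormalForm_mk`). For this it suffices that normal forms are preserved by composition with each
generator on some of the wires (`preserves_mk`).

*Reduction to the white counit.* For the affine generators and for `gauss` and `bunit` this is
clear. The black multiplication is given by `copy` and `cap` (`bmul_eq`), and the white
comultiplication by `add` and the unconstrained pairs of opposite wires (`wcomul_eq`). The axioms
contain neither the unit laws nor the commutativity of these operations; what is needed of them
comes from the snake equation, which is the axiom on mirrored scalars for the scalar `1`. As `cap`
is `add ≫ wcounit` up to a sign, only `wcounit` remains.

*Pulling back conditions.* A functional `a` on `n` wires is represented by the shear
`(x, r) ↦ (x, a x + r)`, and `Pull f a a'` says that `f` intertwines the shears by `a'` and `a`.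
Functionals have pullbacks along affine morphisms, which is checked on generators
(`Uses.hasPullbacks`). Conditioning on `a x = 0` is a morphism `filter a`: it adds a wire with value
zero, shears, and conditions the last wire to be zero. Then `Pull f a a'` implies that
`f ≫ filter a = filter a' ≫ f`, so a condition on `α ≫ S ≫ A` turns into one on `S`.

*Conditioning a source* (`IsSource.canCondition`). If an unconstrained wire occurs in the condition,
the condition is solved for this wire. Otherwise the Gaussians are rotated, which does not change
their joint distribution, such that the condition involves only one of them; this Gaussian becomes a
constant `c`, and the scalar `cost c` appears. If nothing occurs in the condition, it holds
trivially or produces the scalar `infinity`.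

*Scalars.* That `cost c ≫ cost d` is again a cost (`cost_comp_cost`) follows by evaluating two
commuting conditions on two Gaussians in both orders. The scalar `infinity` absorbs all costs.
-/

namespace GQA

/-! ### The prop of diagrams up to provable equality -/

/-- Provable equality as an equivalence relation on diagrams of a given type. -/
def provableSetoid (m n : ℕ) : Setoid (Diagram m n) where
  r := Provable
  iseqv := ⟨.refl, .symm, .trans⟩

/-- The morphisms `m → n` of the prop GQA: diagrams up to provable equality. -/
def Mor (m n : ℕ) : Type := Quotient (provableSetoid m n)

namespace Mor

/-- The morphism denoted by a diagram. -/
def mk {m n : ℕ} (f : Diagram m n) : Mor m n := Quotient.mk (provableSetoid m n) f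

/-- Sequential composition of morphisms, in diagrammatic order. -/
def comp {m n p : ℕ} (f : Mor m n) (g : Mor n p) : Mor m p :=
  Quotient.map₂ (sa := provableSetoid m n) (sb := provableSetoid n p) (sc := provableSetoid m p)
    Term.comp (fun _ _ h₁ _ _ h₂ => Derivable.comp_congr h₁ h₂) f g

/-- Parallel composition of morphisms. -/
def tensor {m n p q : ℕ} (f : Mor m n) (g : Mor p q) : Mor (m + p) (n + q) :=
  Quotient.map₂ (sa := provableSetoid m n) (sb := provableSetoid p q)
    (sc := provableSetoid (m + p) (n + q))
    Term.tensor (fun _ _ h₁ _ _ h₂ => Derivable.tensor_congr h₁ h₂) f g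

/-- Transport of a morphism along equalities of its source and target. -/
def cast {m n m' n' : ℕ} (hm : m = m') (hn : n = n') (f : Mor m n) : Mor m' n' :=
  hm ▸ hn ▸ f

infixr:65 " ≫ " => Mor.comp

-- The factors are elaborated without an expected type, since the sums `m + p` and `n + q` in the
-- type of the composite cannot be unified with the numbers of wires known from the context.
notation:75 f:75 " ⊗ " g:76 => (Mor.tensor f g :)

/-- The identity on `n` wires. -/
def id (n : ℕ) : Mor n n := mk (.id n)

/-- The symmetry exchanging `m` wires with `n` wires. -/
def swap (m n : ℕ) : Mor (m + n) (n + m) := mk (.swap m n)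

notation "𝟙" => Mor.id

variable {m n p q m' n' p' q' : ℕ}

theorem mk_eq_iff {f g : Diagram m n} : mk f = mk g ↔ Provable f g :=
  ⟨fun h => Quotient.exact h, fun h => Quotient.sound (s := provableSetoid m n) h⟩

theorem mk_comp (f : Diagram m n) (g : Diagram n p) : mk (f ⨾ g) = mk f ≫ mk g := rfl

theorem mk_tensor (f : Diagram m n) (g : Diagram p q) : mk (f ⊕ₚ g) = mk f ⊗ mk g := rfl

theorem mk_id (n : ℕ) : mk (.id n) = 𝟙 n := rfl

theorem mk_swap (m n : ℕ) : mk (.swap m n) = swap m n := rfl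

theorem mk_cast (hm : m = m') (hn : n = n') (f : Diagram m n) :
    mk (f.cast hm hn) = (mk f).cast hm hn := by
  subst hm hn; rfl

theorem ind {P : Mor m n → Prop} (h : ∀ f : Diagram m n, P (mk f)) (f : Mor m n) : P f :=
  Quotient.ind (s := provableSetoid m n) h f

theorem comp_assoc (f : Mor m n) (g : Mor n p) (h : Mor p q) :
    (f ≫ g) ≫ h = f ≫ g ≫ h := by
  induction f using ind; induction g using ind; induction h using ind
  exact mk_eq_iff.2 (.comp_assoc _ _ _)

theorem id_comp (f : Mor m n) : 𝟙 m ≫ f = f := by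
  induction f using ind
  exact mk_eq_iff.2 (.id_comp _)

theorem comp_id (f : Mor m n) : f ≫ 𝟙 n = f := by
  induction f using ind
  exact mk_eq_iff.2 (.comp_id _)

theorem id_tensor_id (m n : ℕ) : 𝟙 m ⊗ 𝟙 n = 𝟙 (m + n) := mk_eq_iff.2 (.id_tensor_id _ _)

theorem interchange (f : Mor m n) (g : Mor n p) (f' : Mor m' n') (g' : Mor n' p') :
    (f ≫ g) ⊗ (f' ≫ g') = (f ⊗ f') ≫ (g ⊗ g') := by
  induction f using ind; induction g using ind; induction f' using ind; induction g' using ind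
  exact mk_eq_iff.2 (.interchange _ _ _ _)

theorem tensor_assoc (f : Mor m n) (g : Mor p q) (h : Mor m' n') :
    (f ⊗ g ⊗ h).cast (Nat.add_assoc m p m') (Nat.add_assoc n q n') = f ⊗ (g ⊗ h) := by
  induction f using ind; induction g using ind; induction h using ind
  simp only [← mk_tensor, ← mk_cast]
  exact mk_eq_iff.2 (.tensor_assoc _ _ _)

theorem empty_tensor (f : Mor m n) :
    (𝟙 0 ⊗ f).cast (Nat.zero_add m) (Nat.zero_add n) = f := by
  induction f using ind
  simp only [← mk_tensor, ← mk_cast, ← mk_id]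
  exact mk_eq_iff.2 (.empty_tensor _)

theorem tensor_empty (f : Mor m n) : (f ⊗ 𝟙 0 : Mor m n) = f := by
  induction f using ind
  exact mk_eq_iff.2 (.tensor_empty _)

theorem swap_natural (f : Mor m n) (g : Mor p q) :
    (f ⊗ g) ≫ swap n q = swap m p ≫ (g ⊗ f) := by
  induction f using ind; induction g using ind
  exact mk_eq_iff.2 (.swap_natural _ _)

theorem swap_swap (m n : ℕ) : swap m n ≫ swap n m = 𝟙 (m + n) :=
  mk_eq_iff.2 (.swap_swap _ _)

theorem swap_add (m n p : ℕ) :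
    swap m (n + p) = (swap m n ⊗ 𝟙 p).cast (Nat.add_assoc m n p) (Nat.add_assoc n m p) ≫
      (𝟙 n ⊗ swap m p).cast rfl (Nat.add_assoc n p m).symm := by
  simp only [← mk_tensor, ← mk_cast, ← mk_id, ← mk_swap, ← mk_comp]
  exact mk_eq_iff.2 (.swap_add _ _ _)

/-- A rewriting rule for the first two factors of a composite can be applied before a further
factor. -/
theorem reassoc {f : Mor m n} {g : Mor n p} {k : Mor m p} (h : f ≫ g = k) (x : Mor p q) :
    f ≫ g ≫ x = k ≫ x := by
  rw [← comp_assoc, h]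

/-! Associativity of `⊗` without a transport: when the numbers of wires of the last factor are
numerals, both sides have the same type by definition. -/

theorem assoc₀₁ (f : Mor m n) (g : Mor p q) (h : Mor 0 1) : f ⊗ g ⊗ h = f ⊗ (g ⊗ h) :=
  tensor_assoc f g h
theorem assoc₁₀ (f : Mor m n) (g : Mor p q) (h : Mor 1 0) : f ⊗ g ⊗ h = f ⊗ (g ⊗ h) :=
  tensor_assoc f g h
theorem assoc₁₁ (f : Mor m n) (g : Mor p q) (h : Mor 1 1) : f ⊗ g ⊗ h = f ⊗ (g ⊗ h) :=
  tensor_assoc f g h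
theorem assoc₁₂ (f : Mor m n) (g : Mor p q) (h : Mor 1 2) : f ⊗ g ⊗ h = f ⊗ (g ⊗ h) :=
  tensor_assoc f g h
theorem assoc₂₁ (f : Mor m n) (g : Mor p q) (h : Mor 2 1) : f ⊗ g ⊗ h = f ⊗ (g ⊗ h) :=
  tensor_assoc f g h
theorem assoc₂₂ (f : Mor m n) (g : Mor p q) (h : Mor 2 2) : f ⊗ g ⊗ h = f ⊗ (g ⊗ h) :=
  tensor_assoc f g h
theorem assoc₀₂ (f : Mor m n) (g : Mor p q) (h : Mor 0 2) : f ⊗ g ⊗ h = f ⊗ (g ⊗ h) :=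
  tensor_assoc f g h
theorem assoc₂₀ (f : Mor m n) (g : Mor p q) (h : Mor 2 0) : f ⊗ g ⊗ h = f ⊗ (g ⊗ h) :=
  tensor_assoc f g h

theorem comp_tensor_id (f : Mor m n) (g : Mor n p) (q : ℕ) :
    (f ≫ g) ⊗ 𝟙 q = (f ⊗ 𝟙 q) ≫ (g ⊗ 𝟙 q) := by
  rw [← interchange, comp_id]

theorem id_tensor_comp (q : ℕ) (f : Mor m n) (g : Mor n p) :
    𝟙 q ⊗ (f ≫ g) = (𝟙 q ⊗ f) ≫ (𝟙 q ⊗ g) := by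
  rw [← interchange, comp_id]

theorem slide (f : Mor m n) (g : Mor p q) : (f ⊗ 𝟙 p) ≫ (𝟙 n ⊗ g) = f ⊗ g := by
  rw [← interchange, comp_id, id_comp]

theorem slide' (f : Mor m n) (g : Mor p q) : (𝟙 m ⊗ g) ≫ (f ⊗ 𝟙 q) = f ⊗ g := by
  rw [← interchange, comp_id, id_comp]

/-- Morphisms on disjoint wires commute. -/
theorem slide_comm (f : Mor m n) (g : Mor p q) :
    (f ⊗ 𝟙 p) ≫ (𝟙 n ⊗ g) = (𝟙 m ⊗ g) ≫ (f ⊗ 𝟙 q) := by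
  rw [slide, slide']

/-! ### Generators and the affine axioms -/

/-- Black comultiplication: copying of a wire. -/
def copy : Mor 1 2 := mk Diagram.copy

/-- Black counit: discarding of a wire. -/
def discard : Mor 1 0 := mk Diagram.discard

/-- White multiplication: addition of two wires. -/
def add : Mor 2 1 := mk Diagram.add

/-- White unit: the constant zero. -/
def zero : Mor 0 1 := mk Diagram.zero

/-- Multiplication by a real number. -/
def scalar (k : ℝ) : Mor 1 1 := mk (Diagram.scalar k)

/-- The constant one. -/
def one : Mor 0 1 := mk Diagram.one

/-- The quadratic generator: a standard Gaussian. -/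
def gauss : Mor 0 1 := mk Diagram.gauss

/-- Black multiplication: conditioning two wires to be equal. -/
def bmul : Mor 2 1 := mk Diagram.bmul

/-- Black unit: an unconstrained wire. -/
def bunit : Mor 0 1 := mk Diagram.bunit

/-- White comultiplication: two unconstrained wires with a given sum. -/
def wcomul : Mor 1 2 := mk Diagram.wcomul

/-- White counit: conditioning a wire to be zero. -/
def wcounit : Mor 1 0 := mk Diagram.wcounit

/-- The crossing of two wires. -/
def cross : Mor 2 2 := swap 1 1

theorem add_assoc : (add ⊗ 𝟙 1) ≫ add = (𝟙 1 ⊗ add) ≫ add := mk_eq_iff.2 (.ax .add_assoc)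
theorem add_comm : cross ≫ add = add := mk_eq_iff.2 (.ax .add_comm)
theorem zero_add : (zero ⊗ 𝟙 1) ≫ add = 𝟙 1 := mk_eq_iff.2 (.ax .zero_add)
theorem one_copy : one ≫ copy = one ⊗ one := mk_eq_iff.2 (.ax .one_copy)
theorem copy_assoc : copy ≫ (copy ⊗ 𝟙 1) = copy ≫ (𝟙 1 ⊗ copy) := mk_eq_iff.2 (.ax .copy_assoc)
theorem copy_comm : copy ≫ cross = copy := mk_eq_iff.2 (.ax .copy_comm)
theorem copy_discard : copy ≫ (discard ⊗ 𝟙 1) = 𝟙 1 := mk_eq_iff.2 (.ax .copy_discard)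
theorem one_discard : one ≫ discard = 𝟙 0 := mk_eq_iff.2 (.ax .one_discard)
theorem add_scalar (k : ℝ) : add ≫ scalar k = (scalar k ⊗ scalar k) ≫ add :=
  mk_eq_iff.2 (.ax (.add_scalar k))
theorem zero_scalar (k : ℝ) : zero ≫ scalar k = zero := mk_eq_iff.2 (.ax (.zero_scalar k))
theorem scalar_copy (k : ℝ) : scalar k ≫ copy = copy ≫ (scalar k ⊗ scalar k) :=
  mk_eq_iff.2 (.ax (.scalar_copy k))
theorem scalar_discard (k : ℝ) : scalar k ≫ discard = discard :=
  mk_eq_iff.2 (.ax (.scalar_discard k))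
theorem scalar_mul (k l : ℝ) : scalar k ≫ scalar l = scalar (k * l) :=
  mk_eq_iff.2 (.ax (.scalar_mul k l))
theorem scalar_add (k l : ℝ) : copy ≫ (scalar k ⊗ scalar l) ≫ add = scalar (k + l) := by
  rw [← comp_assoc]; exact mk_eq_iff.2 (.ax (.scalar_add k l))
theorem scalar_zero : scalar 0 = discard ≫ zero := mk_eq_iff.2 (.ax .scalar_zero)
theorem scalar_one : scalar 1 = 𝟙 1 := mk_eq_iff.2 (.ax .scalar_one)
theorem add_copy :
    add ≫ copy = (copy ⊗ copy) ≫ (𝟙 1 ⊗ cross ⊗ 𝟙 1) ≫ (add ⊗ add) := by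
  rw [← comp_assoc]; exact mk_eq_iff.2 (.ax .add_copy)
theorem zero_copy : zero ≫ copy = zero ⊗ zero := mk_eq_iff.2 (.ax .zero_copy)
theorem zero_discard : zero ≫ discard = 𝟙 0 := mk_eq_iff.2 (.ax .zero_discard)
theorem add_discard : add ≫ discard = discard ⊗ discard := mk_eq_iff.2 (.ax .add_discard)

theorem cross_cross : cross ≫ cross = 𝟙 2 := swap_swap 1 1

/-- The morphism `(y, r) ↦ b * y + r`. -/
def mulAdd (b : ℝ) : Mor 2 1 := (scalar b ⊗ 𝟙 1) ≫ add

/-- The constant `c`. -/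
def const (c : ℝ) : Mor 0 1 := one ≫ scalar c

/-- The translation `r ↦ c + r`. -/
def translate (c : ℝ) : Mor 1 1 := (const c ⊗ 𝟙 1 : Mor 1 2) ≫ add

/-- Both sides are `(y₁, y₂, r) ↦ b₁ * y₁ + b₂ * y₂ + r`. -/
theorem mulAdd_mulAdd (b₁ b₂ : ℝ) : (𝟙 1 ⊗ mulAdd b₂) ≫ mulAdd b₁ =
    (((scalar b₁ ⊗ scalar b₂) ≫ add) ⊗ 𝟙 1) ≫ add := by
  rw [comp_tensor_id, comp_assoc, add_assoc, mulAdd, mulAdd, assoc₁₁, ← comp_assoc, ← comp_assoc,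
    slide', ← interchange, comp_id]

theorem add_mulAdd (b : ℝ) : (add ⊗ 𝟙 1) ≫ mulAdd b = (𝟙 1 ⊗ mulAdd b) ≫ mulAdd b := by
  rw [mulAdd_mulAdd, ← add_scalar, comp_tensor_id, comp_assoc]; rfl

theorem zero_mulAdd (b : ℝ) : (zero ⊗ 𝟙 1 : Mor 1 2) ≫ mulAdd b = 𝟙 1 := by
  rw [mulAdd, ← comp_assoc, ← comp_tensor_id, zero_scalar, zero_add]

theorem scalar_mulAdd (k b : ℝ) : (scalar k ⊗ 𝟙 1) ≫ mulAdd b = mulAdd (k * b) := by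
  rw [mulAdd, ← comp_assoc, ← comp_tensor_id, scalar_mul]; rfl

theorem copy_mulAdd (b₁ b₂ : ℝ) :
    (copy ⊗ 𝟙 1) ≫ (𝟙 1 ⊗ mulAdd b₂) ≫ mulAdd b₁ = mulAdd (b₁ + b₂) := by
  rw [mulAdd_mulAdd, ← comp_assoc, ← comp_tensor_id, scalar_add]; rfl

theorem mulAdd_zero : mulAdd 0 = discard ⊗ 𝟙 1 := by
  rw [mulAdd, scalar_zero, comp_tensor_id, comp_assoc, zero_add, comp_id]

theorem cross_mulAdd (b₁ b₂ : ℝ) :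
    (cross ⊗ 𝟙 1) ≫ (𝟙 1 ⊗ mulAdd b₂) ≫ mulAdd b₁ = (𝟙 1 ⊗ mulAdd b₁) ≫ mulAdd b₂ := by
  rw [mulAdd_mulAdd, mulAdd_mulAdd, ← comp_assoc, ← comp_tensor_id, cross, ← comp_assoc,
    ← swap_natural, comp_assoc, ← cross, add_comm]

theorem one_mulAdd (b : ℝ) : (one ⊗ 𝟙 1 : Mor 1 2) ≫ mulAdd b = translate b := by
  rw [mulAdd, ← comp_assoc, ← comp_tensor_id]; rfl

theorem add_translate' (c : ℝ) : add ≫ translate c = (translate c ⊗ 𝟙 1) ≫ add := by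
  have h : add ≫ (const c ⊗ 𝟙 1) = (const c ⊗ (𝟙 1 ⊗ 𝟙 1)) ≫ (𝟙 1 ⊗ add) := by
    have e := slide' (const c) add
    rw [show (𝟙 0 ⊗ add : Mor 2 1) = add from empty_tensor add] at e
    rw [id_tensor_id, slide]
    exact e
  rw [translate, ← comp_assoc, h, comp_assoc, ← add_assoc, comp_tensor_id, assoc₁₁, comp_assoc]

theorem add_translate (c : ℝ) : add ≫ translate c = (𝟙 1 ⊗ translate c) ≫ add := by
  rw [← add_comm, comp_assoc, add_translate', ← comp_assoc, ← comp_assoc, cross,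
    ← swap_natural]

theorem mulAdd_translate (b c : ℝ) : mulAdd b ≫ translate c = (𝟙 1 ⊗ translate c) ≫ mulAdd b := by
  rw [mulAdd, comp_assoc, add_translate, ← comp_assoc, ← comp_assoc, slide_comm]

theorem const_const_add (c d : ℝ) : (const c ⊗ const d) ≫ add = const (c + d) := by
  rw [const, const, interchange, ← one_copy, const, ← scalar_add, comp_assoc, comp_assoc]

theorem translate_translate (c d : ℝ) : translate c ≫ translate d = translate (c + d) := by
  have h : const c ≫ translate d = const (d + c) := by
    rw [← const_const_add, ← slide', comp_assoc,
      show (𝟙 0 ⊗ const c : Mor 0 1) = const c from empty_tensor (const c), translate]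
  rw [translate, comp_assoc, add_translate', ← comp_assoc, ← comp_tensor_id, h,
    _root_.add_comm d]
  rfl

/-! ### Elementary shears -/

theorem swap_one_two : swap 1 2 = (cross ⊗ 𝟙 1) ≫ (𝟙 1 ⊗ cross) := swap_add 1 1 1

theorem swap_two_one : swap 2 1 = (𝟙 1 ⊗ cross) ≫ (cross ⊗ 𝟙 1) := by
  have h : swap 1 2 ≫ (𝟙 1 ⊗ cross) ≫ (cross ⊗ 𝟙 1) = 𝟙 3 := by
    rw [swap_one_two, comp_assoc, ← comp_assoc (𝟙 1 ⊗ cross), ← id_tensor_comp, cross_cross,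
      id_tensor_id, id_comp, ← comp_tensor_id, cross_cross, id_tensor_id]
  rw [← comp_id (swap 2 1)]
  erw [← h]
  rw [← comp_assoc, swap_swap]
  exact id_comp _

theorem id_two_tensor₁₁ (f : Mor 1 1) : 𝟙 2 ⊗ f = 𝟙 1 ⊗ (𝟙 1 ⊗ f) := by
  rw [← assoc₁₁, id_tensor_id]
theorem id_two_tensor₁₂ (f : Mor 1 2) : 𝟙 2 ⊗ f = 𝟙 1 ⊗ (𝟙 1 ⊗ f) := by
  rw [← assoc₁₂, id_tensor_id]
theorem id_two_tensor₂₂ (f : Mor 2 2) : 𝟙 2 ⊗ f = 𝟙 1 ⊗ (𝟙 1 ⊗ f) := by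
  rw [← assoc₂₂, id_tensor_id]
theorem id_two_tensor₂₃ (f : Mor 2 3) : 𝟙 2 ⊗ f = 𝟙 1 ⊗ (𝟙 1 ⊗ f) :=
  (congrArg (· ⊗ f) (id_tensor_id 1 1)).symm.trans (tensor_assoc (𝟙 1) (𝟙 1) f)
theorem id_two_tensor₃₁ (f : Mor 3 1) : 𝟙 2 ⊗ f = 𝟙 1 ⊗ (𝟙 1 ⊗ f) :=
  (congrArg (· ⊗ f) (id_tensor_id 1 1)).symm.trans (tensor_assoc (𝟙 1) (𝟙 1) f)

/-- The elementary shear `(y, r) ↦ (y, b * y + r)`. -/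
def shear₁ (b : ℝ) : Mor 2 2 := (copy ⊗ 𝟙 1) ≫ (𝟙 1 ⊗ mulAdd b)

/-- The shear `(y₁, y₂, r) ↦ (y₁, y₂, b₁ * y₁ + b₂ * y₂ + r)`. -/
def shear₂ (b₁ b₂ : ℝ) : Mor 3 3 :=
  (𝟙 1 ⊗ cross) ≫ (shear₁ b₁ ⊗ 𝟙 1) ≫ (𝟙 1 ⊗ cross) ≫ (𝟙 1 ⊗ shear₁ b₂)

/-- Copying of two wires: `(y₁, y₂) ↦ (y₁, y₂, y₁, y₂)`. -/
def copy₂ : Mor 2 4 := (copy ⊗ copy) ≫ (𝟙 1 ⊗ cross ⊗ 𝟙 1)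

/-- The first factor of `shear₂` acts on the outer two of three wires; here it is written as copying
followed by an operation on the last three wires. -/
theorem shear₁_conj (b : ℝ) :
    (𝟙 1 ⊗ cross) ≫ (shear₁ b ⊗ 𝟙 1) ≫ (𝟙 1 ⊗ cross) =
      (copy ⊗ 𝟙 2) ≫ (𝟙 1 ⊗ ((cross ⊗ 𝟙 1) ≫ (𝟙 1 ⊗ mulAdd b))) := by
  have h₁ : (𝟙 1 ⊗ cross) ≫ (copy ⊗ 𝟙 1 ⊗ 𝟙 1) = (copy ⊗ 𝟙 2) ≫ (𝟙 1 ⊗ (𝟙 1 ⊗ cross)) := by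
    rw [assoc₁₁, id_tensor_id, slide', ← assoc₂₂, id_tensor_id, slide]
  have h₂ : (mulAdd b ⊗ 𝟙 1) ≫ cross = swap 2 1 ≫ (𝟙 1 ⊗ mulAdd b) := swap_natural _ _
  have h₃ : (𝟙 1 ⊗ cross) ≫ swap 2 1 = (cross ⊗ 𝟙 1) := by
    rw [swap_two_one, ← comp_assoc, ← id_tensor_comp, cross_cross, id_tensor_id]
    exact id_comp _
  rw [shear₁, comp_tensor_id, comp_assoc, ← comp_assoc, h₁, comp_assoc, assoc₁₁,
    ← id_tensor_comp, h₂, ← id_tensor_comp, ← comp_assoc (𝟙 1 ⊗ cross), h₃]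

/-- The two-step shear copies both wires and adds a combination of the copies to the last wire. -/
theorem shear₂_eq (b₁ b₂ : ℝ) : shear₂ b₁ b₂ =
    (copy₂ ⊗ 𝟙 1) ≫ (𝟙 2 ⊗ ((𝟙 1 ⊗ mulAdd b₂) ≫ mulAdd b₁)) := by
  have h₁ : (𝟙 1 ⊗ mulAdd b₁) ≫ (copy ⊗ 𝟙 1) = (copy ⊗ 𝟙 2) ≫ (𝟙 1 ⊗ (𝟙 1 ⊗ mulAdd b₁)) := by
    rw [slide', ← assoc₂₁, id_tensor_id, slide]
  have h₂ : (cross ⊗ 𝟙 1) ≫ (copy ⊗ 𝟙 2) =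
      (𝟙 1 ⊗ (copy ⊗ 𝟙 1)) ≫ (cross ⊗ 𝟙 2) ≫ (𝟙 1 ⊗ (cross ⊗ 𝟙 1)) := by
    have e : (𝟙 1 ⊗ copy) ≫ swap 1 2 = cross ≫ (copy ⊗ 𝟙 1) := swap_natural _ _
    have e₂ : copy ⊗ 𝟙 2 = copy ⊗ 𝟙 1 ⊗ 𝟙 1 := by rw [assoc₁₁, id_tensor_id]
    have e₃ : cross ⊗ 𝟙 2 = cross ⊗ 𝟙 1 ⊗ 𝟙 1 := by rw [assoc₁₁, id_tensor_id]
    rw [e₂, ← comp_tensor_id, ← e, e₃, ← assoc₁₁, ← assoc₁₁, ← comp_tensor_id, swap_one_two,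
      ← comp_tensor_id]
  have h₃ : (cross ⊗ 𝟙 1) ≫ (𝟙 1 ⊗ mulAdd b₁) ≫ shear₁ b₂ =
      (𝟙 1 ⊗ (copy ⊗ 𝟙 1)) ≫ (cross ⊗ 𝟙 2) ≫
        (𝟙 1 ⊗ ((𝟙 1 ⊗ mulAdd b₂) ≫ mulAdd b₁)) := by
    rw [shear₁, reassoc h₁, comp_assoc, reassoc h₂, comp_assoc, comp_assoc, ← id_tensor_comp,
      ← id_tensor_comp, cross_mulAdd]
  have h₄ : (𝟙 1 ⊗ cross) ≫ (shear₁ b₁ ⊗ 𝟙 1) ≫ (𝟙 1 ⊗ cross) ≫ (𝟙 1 ⊗ shear₁ b₂) =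
     ((𝟙 1 ⊗ cross) ≫ (shear₁ b₁ ⊗ 𝟙 1) ≫ (𝟙 1 ⊗ cross)) ≫ (𝟙 1 ⊗ shear₁ b₂) := by
    rw [comp_assoc, comp_assoc]
  have h₅ : (copy ⊗ copy) ⊗ 𝟙 1 = (copy ⊗ 𝟙 2) ≫ (𝟙 1 ⊗ (𝟙 1 ⊗ (copy ⊗ 𝟙 1))) := by
    rw [assoc₁₁, ← slide, id_two_tensor₂₃]
  rw [shear₂, h₄, shear₁_conj, comp_assoc, ← id_tensor_comp, comp_assoc, h₃, id_tensor_comp,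
    id_tensor_comp, copy₂, comp_tensor_id, comp_assoc, h₅, comp_assoc, id_two_tensor₃₁,
    assoc₁₁ (𝟙 1 ⊗ cross), id_tensor_id, assoc₂₂]

theorem copy_copy₂ : copy ≫ copy₂ = copy ≫ (copy ⊗ copy) := by
  have h : copy ≫ (copy ⊗ copy) = copy ≫ (𝟙 1 ⊗ (copy ≫ (copy ⊗ 𝟙 1))) := by
    rw [← slide, ← comp_assoc, copy_assoc, comp_assoc, id_two_tensor₁₂, ← id_tensor_comp]
  rw [copy₂, ← comp_assoc, h, comp_assoc, assoc₁₁, ← id_tensor_comp, comp_assoc,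
    ← comp_tensor_id, copy_comm]

theorem cross_copy₂ : cross ≫ copy₂ = copy₂ ≫ (cross ⊗ cross) := by
  have h₁ : cross ≫ (copy ⊗ copy) = (copy ⊗ copy) ≫ swap 2 2 := (swap_natural copy copy).symm
  have h₂ : swap 2 2 = (swap 2 1 ⊗ 𝟙 1) ≫ (𝟙 1 ⊗ swap 2 1) := swap_add 2 1 1
  have h₃ : swap 2 1 ≫ (cross ⊗ 𝟙 1) = 𝟙 1 ⊗ cross := by
    rw [swap_two_one, comp_assoc, ← comp_tensor_id, cross_cross, id_tensor_id, comp_id]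
  rw [copy₂, reassoc h₁, h₂, comp_assoc, comp_assoc, comp_assoc, assoc₁₁ (𝟙 1) cross,
    ← id_tensor_comp, h₃, swap_two_one, comp_tensor_id, comp_assoc, ← id_two_tensor₂₂,
    assoc₁₁ cross, id_tensor_id, slide, assoc₁₁]

/-- If `f` commutes with copying and pulls the functional `r'` back to `r`, it intertwines the
shears by these functionals. -/
theorem tensor_comp_shear {f : Mor m n} {c : Mor m (m + m)} {c' : Mor n (n + n)}
    {r : Mor (m + 1) 1} {r' : Mor (n + 1) 1} (hc : f ≫ c' = c ≫ (f ⊗ f))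
    (hr : (f ⊗ 𝟙 1) ≫ r' = r) :
    (f ⊗ 𝟙 1) ≫ (c' ⊗ 𝟙 1) ≫ (𝟙 n ⊗ r') = ((c ⊗ 𝟙 1) ≫ (𝟙 m ⊗ r)) ≫ (f ⊗ 𝟙 1) := by
  rw [← comp_assoc, ← comp_tensor_id, hc, comp_tensor_id, comp_assoc, assoc₁₁, comp_assoc, slide',
    ← interchange, comp_id, hr]

/-- By the hexagon law this symmetry is idempotent; since it is invertible, it is the identity. -/
theorem swap_one_zero : swap 1 0 = 𝟙 1 := by
  have h : swap 1 0 = swap 1 0 ≫ swap 1 0 := by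
    have e₁ : (swap 1 0 ⊗ 𝟙 0 : Mor 1 1) = swap 1 0 := tensor_empty (m := 1) (n := 1) (swap 1 0)
    have e₂ : (𝟙 0 ⊗ swap 1 0 : Mor 1 1) = swap 1 0 := empty_tensor (m := 1) (n := 1) (swap 1 0)
    have e := swap_add 1 0 0
    exact e.trans (congrArg₂ (comp (m := 1) (n := 1) (p := 1)) e₁ e₂)
  have h' : swap 1 0 ≫ swap 0 1 = 𝟙 1 := swap_swap 1 0
  rw [← comp_id (swap 1 0)]
  erw [← h']
  rw [← comp_assoc]
  erw [← h, h']

theorem swap_zero_one : swap 0 1 = 𝟙 1 := by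
  have h : swap 0 1 ≫ swap 1 0 = 𝟙 1 := swap_swap 0 1
  rw [swap_one_zero] at h
  exact (comp_id (m := 1) (n := 1) (swap 0 1)).symm.trans h

theorem copy_discard' : copy ≫ (𝟙 1 ⊗ discard) = 𝟙 1 := by
  have e : (discard ⊗ 𝟙 1) ≫ swap 0 1 = cross ≫ (𝟙 1 ⊗ discard) := swap_natural _ _
  rw [swap_zero_one] at e
  rw [← copy_comm, comp_assoc, ← e, ← comp_assoc, copy_discard]
  exact comp_id _

/-- A morphism without inputs can be placed before or after another one. -/
theorem point_tensor (a : Mor 0 1) (f : Mor 1 1) :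
    f ≫ (a ⊗ 𝟙 1 : Mor 1 2) = (a ⊗ f : Mor 1 2) := by
  have e := slide' a f
  rwa [show (𝟙 0 ⊗ f : Mor 1 1) = f from empty_tensor f] at e

theorem shear₁_zero : shear₁ 0 = 𝟙 2 := by
  rw [shear₁, mulAdd_zero, ← assoc₁₁, ← comp_tensor_id, copy_discard', id_tensor_id]

theorem cross_shear₂ (b₁ b₂ : ℝ) :
    (cross ⊗ 𝟙 1) ≫ shear₂ b₁ b₂ = shear₂ b₂ b₁ ≫ (cross ⊗ 𝟙 1) := by
  rw [shear₂_eq, shear₂_eq]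
  exact tensor_comp_shear cross_copy₂ (cross_mulAdd _ _)

theorem copy_shear₂ (b₁ b₂ : ℝ) :
    (copy ⊗ 𝟙 1) ≫ shear₂ b₁ b₂ = shear₁ (b₁ + b₂) ≫ (copy ⊗ 𝟙 1) := by
  rw [shear₂_eq]
  exact tensor_comp_shear copy_copy₂ (copy_mulAdd _ _)

theorem add_shear₁ (b : ℝ) : (add ⊗ 𝟙 1) ≫ shear₁ b = shear₂ b b ≫ (add ⊗ 𝟙 1) := by
  rw [shear₂_eq]
  exact tensor_comp_shear (by rw [add_copy, copy₂, comp_assoc]) (add_mulAdd _)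

theorem scalar_shear₁ (k b : ℝ) :
    (scalar k ⊗ 𝟙 1) ≫ shear₁ b = shear₁ (k * b) ≫ (scalar k ⊗ 𝟙 1) :=
  tensor_comp_shear (scalar_copy k) (scalar_mulAdd k b)

theorem zero_shear₁ (b : ℝ) : (zero ⊗ 𝟙 1 : Mor 1 2) ≫ shear₁ b = zero ⊗ 𝟙 1 := by
  rw [shear₁, ← comp_assoc, ← comp_tensor_id, zero_copy, assoc₁₁, ← slide zero (zero ⊗ 𝟙 1),
    comp_assoc, ← id_tensor_comp, zero_mulAdd, id_tensor_id]
  exact comp_id _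

theorem one_shear₁ (b : ℝ) :
    (one ⊗ 𝟙 1 : Mor 1 2) ≫ shear₁ b = translate b ≫ (one ⊗ 𝟙 1 : Mor 1 2) := by
  rw [shear₁, ← comp_assoc, ← comp_tensor_id, one_copy, assoc₁₁, point_tensor, ← one_mulAdd,
    ← slide one, ← slide one (_ ≫ _), id_tensor_comp, comp_assoc]

theorem shear₁_translate (b c : ℝ) :
    shear₁ b ≫ (𝟙 1 ⊗ translate c) = (𝟙 1 ⊗ translate c) ≫ shear₁ b := by
  rw [shear₁, comp_assoc, ← id_tensor_comp, mulAdd_translate, id_tensor_comp, ← comp_assoc,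
    ← id_two_tensor₁₁, slide_comm, comp_assoc]

end Mor

/-! ### Functionals and their pullbacks -/

/-- Affine functionals on `n` wires: a constant term, followed by one coefficient for each wire. -/
inductive Functional : ℕ → Type
  | const (c : ℝ) : Functional 0
  | snoc {n : ℕ} (a : Functional n) (b : ℝ) : Functional (n + 1)

namespace Functional

/-- The functional `a + c`. -/
def addConst : {n : ℕ} → Functional n → ℝ → Functional n
  | _, const d, c => const (d + c)
  | _, snoc a b, c => snoc (a.addConst c) b

/-- The functional `0`. -/
def zero : (n : ℕ) → Functional n
  | 0 => const 0
  | n + 1 => snoc (zero n) 0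

end Functional

namespace Mor
variable {m n p q k l : ℕ}

theorem cast_comp {m' n' p' : ℕ} (hm : m = m') (hn : n = n') (hp : p = p') (f : Mor m n)
    (g : Mor n p) : f.cast hm hn ≫ g.cast hn hp = (f ≫ g).cast hm hp := by
  subst hm hn hp; rfl

/-- A morphism on `m` wires and a distinguished last wire, which ignores `k` further wires between
these. -/
def liftN (k : ℕ) (s : Mor (m + 1) (m + 1)) : Mor (m + (k + 1)) (m + (k + 1)) :=
  (𝟙 m ⊗ swap k 1) ≫ (s ⊗ 𝟙 k).cast (Nat.add_assoc m 1 k) (Nat.add_assoc m 1 k) ≫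
    (𝟙 m ⊗ swap 1 k)

/-- The case of a single ignored wire: `lift s` applies `s` to all wires except the last but one. -/
def lift (s : Mor (m + 1) (m + 1)) : Mor (m + 2) (m + 2) :=
  (𝟙 m ⊗ cross) ≫ (s ⊗ 𝟙 1) ≫ (𝟙 m ⊗ cross)

/-- Morphisms on the ignored wires commute with `liftN`. -/
theorem liftN_natural (s : Mor (m + 1) (m + 1)) (f : Mor k l) :
    (𝟙 m ⊗ (f ⊗ 𝟙 1)) ≫ liftN l s = liftN k s ≫ (𝟙 m ⊗ (f ⊗ 𝟙 1)) := by
  have e : (𝟙 m ⊗ (𝟙 1 ⊗ f)) =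
      (𝟙 (m + 1) ⊗ f).cast (Nat.add_assoc m 1 k) (Nat.add_assoc m 1 l) := by
    rw [← tensor_assoc, id_tensor_id]
  rw [liftN, liftN, ← comp_assoc, ← id_tensor_comp, swap_natural, id_tensor_comp, comp_assoc,
    comp_assoc, comp_assoc, ← id_tensor_comp (m := 1 + k), ← swap_natural, id_tensor_comp, e,
    ← comp_assoc (cast _ _ _), ← comp_assoc (cast _ _ _), cast_comp, cast_comp, slide, slide']

theorem liftN_zero (s : Mor (m + 1) (m + 1)) : liftN 0 s = s := by
  have e : (s ⊗ 𝟙 0).cast (Nat.add_assoc m 1 0) (Nat.add_assoc m 1 0) = s := tensor_empty s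
  rw [liftN, e]
  have e₁ : (𝟙 m ⊗ swap 0 1 : Mor (m + 1) (m + 1)) = 𝟙 (m + 1) := by
    rw [← id_tensor_id]; exact congrArg _ swap_zero_one
  have e₂ : (𝟙 m ⊗ swap 1 0 : Mor (m + 1) (m + 1)) = 𝟙 (m + 1) := by
    rw [← id_tensor_id]; exact congrArg _ swap_one_zero
  exact (congrArg₂ (fun x y : Mor (m + 1) (m + 1) => x ≫ s ≫ y) e₁ e₂).trans
    ((id_comp _).trans (comp_id s))

theorem liftN_one (s : Mor (m + 1) (m + 1)) : liftN 1 s = lift s := rfl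

theorem liftN_two (s : Mor (m + 1) (m + 1)) : liftN 2 s = lift (m := m + 1) (lift s) := by
  have e : 𝟙 (m + 1) ⊗ cross = 𝟙 m ⊗ (𝟙 1 ⊗ cross) := by rw [← id_tensor_id, assoc₂₂]
  rw [lift, lift, e, comp_tensor_id, comp_tensor_id, assoc₁₁, assoc₁₁, comp_assoc,
    comp_assoc, ← id_tensor_comp, ← swap_one_two, ← comp_assoc, ← id_tensor_comp, ← swap_two_one,
    id_tensor_id]
  rfl

theorem id_succ_tensor₂₂ (f : Mor 2 2) : 𝟙 (m + 1) ⊗ f = 𝟙 m ⊗ (𝟙 1 ⊗ f) := by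
  rw [← id_tensor_id, assoc₂₂]

theorem lift_comp (s t : Mor (m + 1) (m + 1)) : lift (s ≫ t) = lift s ≫ lift t := by
  rw [lift, lift, lift, comp_tensor_id]
  simp only [comp_assoc]
  rw [← comp_assoc (𝟙 m ⊗ cross) (𝟙 m ⊗ cross), ← id_tensor_comp, cross_cross, id_tensor_id,
    id_comp]

/-- The shear `(x, r) ↦ (x, a x + r)`. -/
def shear : {n : ℕ} → Functional n → Mor (n + 1) (n + 1)
  | _, .const c => translate c
  | _, .snoc (n := n) a b => lift (shear a) ≫ (𝟙 n ⊗ shear₁ b)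

theorem shear_snoc (a : Functional n) (b : ℝ) :
    shear (a.snoc b) = lift (shear a) ≫ (𝟙 n ⊗ shear₁ b) := rfl

theorem lift_id_tensor (f : Mor 2 2) :
    lift (𝟙 m ⊗ f) = 𝟙 m ⊗ ((𝟙 1 ⊗ cross) ≫ (f ⊗ 𝟙 1) ≫ (𝟙 1 ⊗ cross)) := by
  rw [lift, id_succ_tensor₂₂, assoc₁₁, ← id_tensor_comp, ← id_tensor_comp]

/-- The part of a shear that concerns the last two wires splits off. Since the remaining part
ignores these wires, pulling back along a generator on the last wires only involves `shear₁` and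
`shear₂`. -/
theorem shear_snoc_snoc (a : Functional n) (b₁ b₂ : ℝ) :
    shear ((a.snoc b₁).snoc b₂) = liftN 2 (shear a) ≫ (𝟙 n ⊗ shear₂ b₁ b₂) := by
  rw [shear, shear, liftN_two, lift_comp, lift_id_tensor, id_succ_tensor₂₂ (m := n) (shear₁ b₂),
    comp_assoc, ← id_tensor_comp, comp_assoc, comp_assoc, shear₂]

theorem id_tensor_lift_translate (c : ℝ) (f : Mor (n + 1) (n + 1)) :
    lift (f ≫ (𝟙 n ⊗ translate c)) = lift f ≫ (𝟙 n ⊗ (𝟙 1 ⊗ translate c)) := by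
  have e : (translate c ⊗ 𝟙 1) ≫ swap 1 1 = swap 1 1 ≫ (𝟙 1 ⊗ translate c) := swap_natural _ _
  rw [lift, lift, comp_tensor_id, assoc₁₁]
  simp only [comp_assoc]
  rw [← id_tensor_comp, cross, e, id_tensor_comp]

theorem shear_addConst (a : Functional n) (c : ℝ) :
    shear (a.addConst c) = shear a ≫ (𝟙 n ⊗ translate c) := by
  induction a with
  | const d =>
    have e : (𝟙 0 ⊗ translate c : Mor 1 1) = translate c := empty_tensor (translate c)
    exact (translate_translate d c).symm.trans (congrArg _ e.symm)
  | snoc a b ih =>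
    rename_i n
    rw [Functional.addConst, shear, shear, ih, id_tensor_lift_translate, comp_assoc, comp_assoc,
      ← id_tensor_id, assoc₁₁, ← id_tensor_comp, ← id_tensor_comp, shear₁_translate]

theorem lift_id : lift (𝟙 (m + 1)) = 𝟙 (m + 2) := by
  rw [lift, id_tensor_id, id_comp, ← id_tensor_comp, cross_cross, id_tensor_id]

theorem shear_zero : shear (Functional.zero n) = 𝟙 (n + 1) := by
  induction n with
  | zero =>
    have e : const 0 = zero := by rw [const, scalar_zero, ← comp_assoc, one_discard, id_comp]
    rw [Functional.zero, shear, translate, e, zero_add]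
  | succ n ih => rw [Functional.zero, shear, ih, lift_id, shear₁_zero, id_comp, id_tensor_id]

/-- `Pull f a a'`: the functional `a` on the outputs of `f` pulls back along `f` to the functional
`a'` on its inputs. This is expressed by the shears of these functionals. -/
def Pull (f : Mor m n) (a : Functional n) (a' : Functional m) : Prop :=
  (f ⊗ 𝟙 1) ≫ shear a = shear a' ≫ (f ⊗ 𝟙 1)

theorem pull_id (a : Functional n) : Pull (𝟙 n) a a := by
  rw [Pull, id_tensor_id, id_comp, comp_id]

theorem Pull.comp {f : Mor m n} {g : Mor n p} {a : Functional p} {b : Functional n}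
    {c : Functional m} (hf : Pull f b c) (hg : Pull g a b) : Pull (f ≫ g) a c := by
  rw [Pull, comp_tensor_id, comp_assoc, hg, ← comp_assoc, hf, comp_assoc]

/-- A further wire is not affected by the pullback. -/
theorem Pull.tensor_id {f : Mor m n} {a : Functional n} {a' : Functional m} (h : Pull f a a')
    (b : ℝ) : Pull (f ⊗ 𝟙 1) (a.snoc b) (a'.snoc b) := by
  have e (f : Mor m n) (g : Mor 2 2) :
      (f ⊗ 𝟙 2) ≫ (𝟙 n ⊗ g) = (𝟙 m ⊗ g) ≫ (f ⊗ 𝟙 2) := slide_comm f g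
  have e' : (f ⊗ 𝟙 2) ≫ (shear a ⊗ 𝟙 1) = (shear a' ⊗ 𝟙 1) ≫ (f ⊗ 𝟙 2) := by
    rw [show 𝟙 2 = 𝟙 1 ⊗ 𝟙 1 from (id_tensor_id 1 1).symm, ← assoc₁₁,
      ← comp_tensor_id, h, comp_tensor_id]
  rw [Pull, assoc₁₁, id_tensor_id, shear_snoc, shear_snoc, lift, lift]
  simp only [comp_assoc]
  rw [reassoc (e f cross), comp_assoc, reassoc e', comp_assoc, reassoc (e f cross), comp_assoc,
    e f (shear₁ b)]

theorem pull_add (a : Functional p) (b : ℝ) :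
    Pull (𝟙 p ⊗ add) (a.snoc b) ((a.snoc b).snoc b) := by
  rw [Pull, assoc₁₁, shear_snoc, shear_snoc_snoc, ← liftN_one, ← comp_assoc, liftN_natural,
    comp_assoc, comp_assoc, ← id_tensor_comp, add_shear₁, id_tensor_comp]

theorem pull_copy (a : Functional p) (b₁ b₂ : ℝ) :
    Pull (𝟙 p ⊗ copy) ((a.snoc b₁).snoc b₂) (a.snoc (b₁ + b₂)) := by
  rw [Pull, assoc₁₁, shear_snoc_snoc, shear_snoc, ← liftN_one, ← comp_assoc, liftN_natural,
    comp_assoc, comp_assoc, ← id_tensor_comp, copy_shear₂, id_tensor_comp]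

theorem pull_cross (a : Functional p) (b₁ b₂ : ℝ) :
    Pull (𝟙 p ⊗ cross) ((a.snoc b₁).snoc b₂) ((a.snoc b₂).snoc b₁) := by
  rw [Pull, assoc₁₁, shear_snoc_snoc, shear_snoc_snoc, ← comp_assoc, liftN_natural,
    comp_assoc, comp_assoc, ← id_tensor_comp, cross_shear₂, id_tensor_comp]

theorem pull_scalar (a : Functional p) (k b : ℝ) :
    Pull (𝟙 p ⊗ scalar k) (a.snoc b) (a.snoc (k * b)) := by
  rw [Pull, assoc₁₁, shear_snoc, shear_snoc, ← liftN_one, ← comp_assoc, liftN_natural,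
    comp_assoc, comp_assoc, ← id_tensor_comp, scalar_shear₁, id_tensor_comp]

theorem shear_source (f : Mor 0 1) (a : Functional p) :
    (𝟙 p ⊗ (f ⊗ 𝟙 1 : Mor 1 2)) ≫ lift (shear a) = shear a ≫ (𝟙 p ⊗ (f ⊗ 𝟙 1 : Mor 1 2)) := by
  have e := liftN_natural (shear a) f
  rw [liftN_zero] at e
  exact e

theorem shear_sink (f : Mor 1 0) (a : Functional p) :
    (𝟙 p ⊗ (f ⊗ 𝟙 1 : Mor 2 1)) ≫ shear a = lift (shear a) ≫ (𝟙 p ⊗ (f ⊗ 𝟙 1 : Mor 2 1)) := by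
  have e := liftN_natural (shear a) f
  rw [liftN_zero] at e
  exact e

theorem source_tensor_id (f : Mor 0 1) :
    (𝟙 p ⊗ f : Mor p (p + 1)) ⊗ 𝟙 1 = 𝟙 p ⊗ (f ⊗ 𝟙 1 : Mor 1 2) := assoc₁₁ (𝟙 p) f (𝟙 1)

theorem sink_tensor_id (f : Mor 1 0) :
    (𝟙 p ⊗ f : Mor (p + 1) p) ⊗ 𝟙 1 = 𝟙 p ⊗ (f ⊗ 𝟙 1 : Mor 2 1) := assoc₁₁ (𝟙 p) f (𝟙 1)

theorem pull_zero (a : Functional p) (b : ℝ) :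
    Pull (𝟙 p ⊗ zero : Mor p (p + 1)) (a.snoc b) a := by
  rw [Pull, source_tensor_id, shear_snoc, ← comp_assoc, shear_source, comp_assoc,
    ← id_tensor_comp, zero_shear₁]

theorem pull_one (a : Functional p) (b : ℝ) :
    Pull (𝟙 p ⊗ one : Mor p (p + 1)) (a.snoc b) (a.addConst b) := by
  rw [Pull, source_tensor_id, shear_snoc, ← comp_assoc, shear_source, comp_assoc,
    ← id_tensor_comp, one_shear₁, shear_addConst, comp_assoc, id_tensor_comp]
  rfl

/-- Every morphism without outputs, for instance `wcounit`, pulls functionals back to functionals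
that ignore its inputs. -/
theorem pull_of_sink (f : Mor 1 0) (a : Functional p) :
    Pull (𝟙 p ⊗ f : Mor (p + 1) p) a (a.snoc 0) := by
  rw [Pull, sink_tensor_id, shear_snoc, shear_sink, shear₁_zero, id_tensor_id, comp_id]

end Mor

/-! ### Pullbacks along affine morphisms -/

/-- The generators of the affine fragment of GQA. -/
def Gen.IsAffine : ⦃m n : ℕ⦄ → Gen m n → Prop
  | _, _, .copy => True
  | _, _, .discard => True
  | _, _, .add => True
  | _, _, .zero => True
  | _, _, .scalar _ => True
  | _, _, .one => True
  | _, _, _ => False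

namespace Mor
variable {m n p q k l : ℕ}

/-- `f` is denoted by a diagram all of whose generators satisfy `P`. -/
def Uses (P : ∀ ⦃m n : ℕ⦄, Gen m n → Prop) (f : Mor m n) : Prop :=
  ∃ t : Diagram m n, t.UsesOnly P ∧ mk t = f

section Uses
variable {P : ∀ ⦃m n : ℕ⦄, Gen m n → Prop}

theorem Uses.gen {s : Gen m n} (h : P s) : Uses P (mk (.gen s)) := ⟨.gen s, h, rfl⟩

theorem uses_id (n : ℕ) : Uses P (𝟙 n) := ⟨.id n, trivial, rfl⟩

theorem uses_swap (m n : ℕ) : Uses P (swap m n) := ⟨.swap m n, trivial, rfl⟩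

theorem Uses.comp {f : Mor m n} {g : Mor n p} (hf : Uses P f) (hg : Uses P g) :
    Uses P (f ≫ g) := by
  obtain ⟨s, hs, rfl⟩ := hf; obtain ⟨t, ht, rfl⟩ := hg
  exact ⟨s ⨾ t, ⟨hs, ht⟩, rfl⟩

theorem Uses.tensor {f : Mor m n} {g : Mor p q} (hf : Uses P f) (hg : Uses P g) :
    Uses P (f ⊗ g) := by
  obtain ⟨s, hs, rfl⟩ := hf; obtain ⟨t, ht, rfl⟩ := hg
  exact ⟨s ⊕ₚ t, ⟨hs, ht⟩, rfl⟩

end Uses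

/-- A family of morphisms that contains the identities and the crossing of two wires, and is closed
under both compositions. -/
structure IsSubprop (P : ∀ {m n : ℕ}, Mor m n → Prop) : Prop where
  id (n : ℕ) : P (𝟙 n)
  comp {m n p : ℕ} {f : Mor m n} {g : Mor n p} : P f → P g → P (f ≫ g)
  tensor {m n p q : ℕ} {f : Mor m n} {g : Mor p q} : P f → P g → P (f ⊗ g)
  cross : P cross

theorem cast_mem {P : ∀ {m n : ℕ}, Mor m n → Prop} {m' n' : ℕ} {f : Mor m n} (hf : P f)
    (hm : m = m') (hn : n = n') : P (f.cast hm hn) := by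
  subst hm hn; exact hf

/-- `f` is an isomorphism, and `f` and its inverse belong to `P`. -/
def IsoMem (P : ∀ {m n : ℕ}, Mor m n → Prop) {m n : ℕ} (f : Mor m n) : Prop :=
  P f ∧ ∃ g : Mor n m, f ≫ g = 𝟙 m ∧ g ≫ f = 𝟙 n ∧ P g

theorem IsSubprop.isoMem {P : ∀ {m n : ℕ}, Mor m n → Prop} (hP : IsSubprop P) :
    IsSubprop (IsoMem P) where
  id n := ⟨hP.id n, 𝟙 n, id_comp _, id_comp _, hP.id n⟩
  comp := by
    rintro m n p f f' ⟨hf, g, h₁, h₂, hg⟩ ⟨hf', g', h₁', h₂', hg'⟩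
    refine ⟨hP.comp hf hf', g' ≫ g, ?_, ?_, hP.comp hg' hg⟩
    · rw [comp_assoc, reassoc h₁', id_comp, h₁]
    · rw [comp_assoc, reassoc h₂, id_comp, h₂']
  tensor := by
    rintro m n p q f f' ⟨hf, g, h₁, h₂, hg⟩ ⟨hf', g', h₁', h₂', hg'⟩
    refine ⟨hP.tensor hf hf', g ⊗ g', ?_, ?_, hP.tensor hg hg'⟩
    · rw [← interchange, h₁, h₁', id_tensor_id]
    · rw [← interchange, h₂, h₂', id_tensor_id]
  cross := ⟨hP.cross, Mor.cross, cross_cross, cross_cross, hP.cross⟩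

/-- The inverse of a symmetry is a symmetry, so it belongs to the family as well. -/
theorem IsoMem.swap {P : ∀ {m n : ℕ}, Mor m n → Prop} (h : IsoMem P (swap m n)) :
    IsoMem P (swap n m) := by
  obtain ⟨h, g, h₁, h₂, hg⟩ := h
  have e : g = Mor.swap n m := by
    rw [← comp_id g, ← swap_swap, reassoc h₂, id_comp]
  exact ⟨e ▸ hg, Mor.swap m n, swap_swap _ _, swap_swap _ _, h⟩

theorem swap_zero_zero : swap 0 0 = 𝟙 0 := by
  have h : swap 0 0 = swap 0 0 ≫ swap 0 0 := by
    have e₁ : (swap 0 0 ⊗ 𝟙 0 : Mor 0 0) = swap 0 0 := tensor_empty (swap 0 0)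
    have e₂ : (𝟙 0 ⊗ swap 0 0 : Mor 0 0) = swap 0 0 := empty_tensor (swap 0 0)
    exact (swap_add 0 0 0).trans (congrArg₂ comp e₁ e₂)
  exact h.trans (swap_swap 0 0)

/-- All symmetries are composed of crossings of two wires. -/
theorem IsSubprop.swap_mem {P : ∀ {m n : ℕ}, Mor m n → Prop} (hP : IsSubprop P) (m n : ℕ) :
    P (swap m n) := by
  suffices h : ∀ m n, IsoMem P (swap m n) from (h m n).1
  have step (m n : ℕ) (h : IsoMem P (swap m n)) (h₁ : IsoMem P (swap m 1)) :
      IsoMem P (swap m (n + 1)) := by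
    rw [swap_add]
    exact hP.isoMem.comp (cast_mem (P := IsoMem P) (hP.isoMem.tensor h (hP.isoMem.id 1)) _ _)
      (cast_mem (P := IsoMem P) (hP.isoMem.tensor (hP.isoMem.id n) h₁) _ _)
  have h₀ (n : ℕ) : IsoMem P (swap 0 n) := by
    induction n with
    | zero => rw [swap_zero_zero]; exact hP.isoMem.id 0
    | succ n ih => exact step 0 n ih (swap_zero_one ▸ hP.isoMem.id 1)
  have h₁ (n : ℕ) : IsoMem P (swap 1 n) := by
    induction n with
    | zero => exact (h₀ 1).swap
    | succ n ih => exact step 1 n ih hP.isoMem.cross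
  intro m n
  induction n with
  | zero => exact (h₀ m).swap
  | succ n ih => exact step m n ih (h₁ m).swap

/-- Every functional on the outputs of `f` has a pullback along `f`. -/
def HasPullbacks (f : Mor m n) : Prop := ∀ a : Functional n, ∃ a', Pull f a a'

theorem HasPullbacks.comp {f : Mor m n} {g : Mor n p} (hf : HasPullbacks f)
    (hg : HasPullbacks g) : HasPullbacks (f ≫ g) := fun a =>
  let ⟨_, hb⟩ := hg a
  let ⟨c, hc⟩ := hf _
  ⟨c, hc.comp hb⟩

theorem HasPullbacks.tensor_id {f : Mor m n} (hf : HasPullbacks f) (q : ℕ) :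
    HasPullbacks (f ⊗ 𝟙 q) := by
  induction q with
  | zero =>
    intro a
    obtain ⟨a', h⟩ := hf a
    exact ⟨a', by rw [Pull] at h ⊢; exact (tensor_empty f).symm ▸ h⟩
  | succ q ih =>
    rintro (_ | ⟨a, b⟩)
    obtain ⟨a', h⟩ := ih a
    refine ⟨a'.snoc b, ?_⟩
    have e : f ⊗ 𝟙 (q + 1) = f ⊗ 𝟙 q ⊗ 𝟙 1 := by rw [assoc₁₁, id_tensor_id]
    rw [e]
    exact h.tensor_id b

theorem isSubprop_hasPullbacks :
    IsSubprop (fun {m n} (f : Mor m n) => ∀ p, HasPullbacks (𝟙 p ⊗ f)) where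
  id n p a := ⟨a, by rw [id_tensor_id]; exact pull_id a⟩
  comp hf hg p := by rw [id_tensor_comp]; exact (hf p).comp (hg p)
  tensor := by
    intro m n m' n' f g hf hg p
    rw [← slide f g, id_tensor_comp, ← tensor_assoc, ← tensor_assoc, id_tensor_id]
    exact (cast_mem (P := HasPullbacks) ((hf p).tensor_id _) _ _).comp
      (cast_mem (P := HasPullbacks) (hg (p + n)) _ _)
  cross p a := match a with | .snoc (.snoc a b₁) b₂ => ⟨_, pull_cross a b₁ b₂⟩

/-- Functionals pull back along affine morphisms. -/
theorem Uses.hasPullbacks {f : Mor m n} (hf : Uses Gen.IsAffine f) : HasPullbacks f := by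
  suffices h : ∀ {m n : ℕ} (t : Diagram m n), t.UsesOnly Gen.IsAffine →
      ∀ p, HasPullbacks (𝟙 p ⊗ mk t) by
    obtain ⟨t, ht, rfl⟩ := hf
    have e := h t ht 0
    rw [← empty_tensor (mk t)]
    exact cast_mem (P := HasPullbacks) e _ _
  intro m n t ht
  have hP := isSubprop_hasPullbacks
  induction t with
  | id n => exact hP.id n
  | swap m n => exact hP.swap_mem m n
  | comp f g hf hg => exact hP.comp (hf ht.1) (hg ht.2)
  | tensor f g hf hg => exact hP.tensor (hf ht.1) (hg ht.2)
  | gen s =>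
    intro p
    cases s <;> first | exact ht.elim | skip
    · rintro (_ | ⟨_ | ⟨a, b₁⟩, b₂⟩); exact ⟨_, pull_copy a b₁ b₂⟩
    · exact fun a => ⟨_, pull_of_sink discard a⟩
    · rintro (_ | ⟨a, b⟩); exact ⟨_, pull_add a b⟩
    · rintro (_ | ⟨a, b⟩); exact ⟨_, pull_zero a b⟩
    · rintro (_ | ⟨a, b⟩); exact ⟨_, pull_scalar a _ b⟩
    · rintro (_ | ⟨a, b⟩); exact ⟨_, pull_one a b⟩

/-! ### The black and the white Frobenius structure, and scalars -/

theorem gauss_discard : gauss ≫ discard = 𝟙 0 := mk_eq_iff.2 (.ax .gauss_discard)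
theorem gauss_wcounit : gauss ≫ wcounit = 𝟙 0 := mk_eq_iff.2 (.ax .gauss_zero)
theorem black_frobenius_left : (copy ⊗ 𝟙 1) ≫ (𝟙 1 ⊗ bmul) = bmul ≫ copy :=
  mk_eq_iff.2 (.ax .black_frobenius_left)
theorem black_frobenius_right : (𝟙 1 ⊗ copy) ≫ (bmul ⊗ 𝟙 1) = bmul ≫ copy :=
  (mk_eq_iff.2 (.ax .black_frobenius_right)).symm
theorem black_special : copy ≫ bmul = 𝟙 1 := mk_eq_iff.2 (.ax .black_special)
theorem black_bone : bunit ≫ discard = 𝟙 0 := mk_eq_iff.2 (.ax .black_bone)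
theorem white_frobenius_left : (wcomul ⊗ 𝟙 1) ≫ (𝟙 1 ⊗ add) = add ≫ wcomul :=
  mk_eq_iff.2 (.ax .white_frobenius_left)
theorem white_frobenius_right : (𝟙 1 ⊗ wcomul) ≫ (add ⊗ 𝟙 1) = add ≫ wcomul :=
  (mk_eq_iff.2 (.ax .white_frobenius_right)).symm
theorem white_special : wcomul ≫ add = 𝟙 1 := mk_eq_iff.2 (.ax .white_special)
theorem white_bone : zero ≫ wcounit = 𝟙 0 := mk_eq_iff.2 (.ax .white_bone)

/-- Conditioning two wires to be equal, and forgetting their value. -/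
def cap : Mor 2 0 := bmul ≫ discard

/-- Two wires carrying the same unconstrained value. -/
def cup : Mor 0 2 := bunit ≫ copy

/-- The mirror image of `scalar k`, bent with `cup` and `cap`. -/
def coscalar (k : ℝ) : Mor 1 1 :=
  (cup ⊗ 𝟙 1 : Mor 1 3) ≫ (𝟙 1 ⊗ scalar k ⊗ 𝟙 1) ≫ (𝟙 1 ⊗ cap)

theorem white_cap : add ≫ wcounit = (𝟙 1 ⊗ scalar (-1)) ≫ cap := mk_eq_iff.2 (.ax .white_cap)

theorem scalar_coscalar {r : ℝ} (hr : r ≠ 0) : scalar r ≫ coscalar r = 𝟙 1 := by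
  rw [coscalar, ← comp_assoc (cup ⊗ 𝟙 1)]
  exact mk_eq_iff.2 (.ax (.scalar_coscalar r hr))

/-- The snake equation, a special case of the axiom on mirrored scalars: the mirror image of
`scalar 1` is its inverse, that is, the identity. The unit laws of `bmul` are not among the axioms,
and are derived from it. -/
theorem snake : (cup ⊗ 𝟙 1 : Mor 1 3) ≫ (𝟙 1 ⊗ cap) = 𝟙 1 := by
  have h := scalar_coscalar one_ne_zero
  rwa [coscalar, scalar_one, id_tensor_id, id_tensor_id, id_comp, id_comp] at h

theorem bunit_bmul : (bunit ⊗ 𝟙 1 : Mor 1 2) ≫ bmul = 𝟙 1 := by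
  refine Eq.trans ?_ snake
  rw [cup, comp_tensor_id, comp_assoc, cap, id_tensor_comp, reassoc black_frobenius_left,
    comp_assoc, copy_discard', comp_id]

theorem bmul_eq : bmul = (copy ⊗ 𝟙 1) ≫ (𝟙 1 ⊗ cap) := by
  rw [cap, id_tensor_comp, reassoc black_frobenius_left, comp_assoc, copy_discard', comp_id]

theorem bmul_eq' : bmul = (𝟙 1 ⊗ copy) ≫ (cap ⊗ 𝟙 1) := by
  rw [cap, comp_tensor_id, reassoc black_frobenius_right, comp_assoc, copy_discard, comp_id]

/-- A morphism without inputs can be placed after another morphism. -/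
theorem tensor_source (f : Mor m n) (a : Mor 0 p) :
    (f ⊗ a : Mor m (n + p)) = f ≫ (𝟙 n ⊗ a : Mor n (n + p)) := by
  have e := slide f a
  rw [show (f ⊗ 𝟙 0 : Mor m n) = f from tensor_empty f] at e
  exact e.symm

theorem copy_sink_comm (θ : Mor 1 0) :
    copy ≫ (θ ⊗ 𝟙 1 : Mor 2 1) = copy ≫ (𝟙 1 ⊗ θ : Mor 2 1) := by
  have e : (θ ⊗ 𝟙 1) ≫ swap 0 1 = cross ≫ (𝟙 1 ⊗ θ) := swap_natural _ _
  rw [swap_zero_one] at e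
  have e' : (θ ⊗ 𝟙 1 : Mor 2 1) = cross ≫ (𝟙 1 ⊗ θ) := (comp_id _).symm.trans e
  rw [e', ← comp_assoc, copy_comm]

/-- A morphism without inputs can be placed before another one. -/
theorem source_tensor (a : Mor 0 n) (f : Mor 0 1) :
    (a ⊗ f : Mor 0 (n + 1)) = f ≫ (a ⊗ 𝟙 1 : Mor 1 (n + 1)) := by
  have e := slide' a f
  rw [show (𝟙 0 ⊗ f : Mor 0 1) = f from empty_tensor f] at e
  exact e.symm

theorem cap_cap : (cap ⊗ 𝟙 2 : Mor 4 2) ≫ cap = (𝟙 2 ⊗ cap : Mor 4 2) ≫ cap := by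
  have e := slide_comm cap cap
  rwa [show (𝟙 0 ⊗ cap : Mor 2 0) = cap from empty_tensor cap,
    show (cap ⊗ 𝟙 0 : Mor 2 0) = cap from tensor_empty cap] at e

theorem id_two_tensor₂₀ (f : Mor 2 0) : 𝟙 2 ⊗ f = 𝟙 1 ⊗ (𝟙 1 ⊗ f) := by
  rw [← assoc₂₀, id_tensor_id]

/-- The right unit law of the black multiplication. The commutativity of `bmul`, which would
reduce it to `bunit_bmul`, is not an axiom. -/
theorem bmul_bunit : (𝟙 1 ⊗ bunit : Mor 1 2) ≫ bmul = 𝟙 1 := by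
  -- Both Frobenius laws describe the right multiplication `P` by the unit. It follows from the
  -- snake equation that `P` can be absorbed by `bmul`, and `P` can be moved along `copy`.
  obtain ⟨P, hP⟩ : ∃ P, P = (𝟙 1 ⊗ bunit : Mor 1 2) ≫ bmul := ⟨_, rfl⟩
  have h₁ : ∃ θ : Mor 1 0, P = copy ≫ (𝟙 1 ⊗ θ : Mor 2 1) := by
    refine ⟨(𝟙 1 ⊗ bunit : Mor 1 2) ≫ cap, ?_⟩
    have e : (𝟙 1 ⊗ bunit : Mor 1 2) ≫ (copy ⊗ 𝟙 1) = copy ≫ (𝟙 1 ⊗ (𝟙 1 ⊗ bunit : Mor 1 2)) := by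
      refine (slide' copy bunit).trans ((tensor_source copy bunit).trans ?_)
      rw [show 𝟙 2 = 𝟙 1 ⊗ 𝟙 1 from (id_tensor_id 1 1).symm, assoc₀₁]
    rw [hP, bmul_eq, reassoc e, comp_assoc, id_tensor_comp]
  have h₂ : P = (𝟙 1 ⊗ cup : Mor 1 3) ≫ (cap ⊗ 𝟙 1) := by
    rw [hP, bmul_eq', cup, id_tensor_comp, comp_assoc]
  have h₃ : (P ⊗ 𝟙 1) ≫ cap = cap := by
    rw [h₂, comp_tensor_id, comp_assoc, assoc₁₁ cap, id_tensor_id, cap_cap, id_two_tensor₂₀,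
      ← comp_assoc, assoc₁₁, ← id_tensor_comp, snake, id_tensor_id, id_comp]
  have h₄ : copy ≫ (P ⊗ 𝟙 1) = P ≫ copy := by
    obtain ⟨θ, h₁⟩ := h₁
    have e : (𝟙 1 ⊗ θ : Mor 2 1) ≫ copy = (copy ⊗ 𝟙 1) ≫ (𝟙 1 ⊗ (𝟙 1 ⊗ θ : Mor 2 1)) := by
      have e₁ := slide_comm copy θ
      rw [show (copy ⊗ 𝟙 0 : Mor 1 2) = copy from tensor_empty copy,
        show 𝟙 2 = 𝟙 1 ⊗ 𝟙 1 from (id_tensor_id 1 1).symm, assoc₁₀] at e₁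
      exact e₁.symm
    rw [h₁, comp_tensor_id, reassoc copy_assoc, comp_assoc, assoc₁₁, ← id_tensor_comp,
      copy_sink_comm, comp_assoc, e, reassoc copy_assoc, comp_assoc, id_tensor_comp]
  have h₅ : (P ⊗ 𝟙 1) ≫ bmul = bmul := by
    rw [bmul_eq', ← comp_assoc, slide_comm, comp_assoc,
      show 𝟙 2 = 𝟙 1 ⊗ 𝟙 1 from (id_tensor_id 1 1).symm, ← assoc₁₁, ← comp_tensor_id, h₃]
  rw [← hP, ← comp_id P, ← black_special, ← comp_assoc, ← h₄, comp_assoc, h₅]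

theorem snake' : (𝟙 1 ⊗ cup : Mor 1 3) ≫ (cap ⊗ 𝟙 1) = 𝟙 1 := by
  refine Eq.trans ?_ bmul_bunit
  rw [bmul_eq', cup, id_tensor_comp, comp_assoc]

/-- Scalars other than zero are invertible, so the mirror image of `scalar k` is `scalar k⁻¹`. -/
theorem coscalar_eq {k : ℝ} (hk : k ≠ 0) : coscalar k = scalar k⁻¹ := by
  rw [← id_comp (coscalar k), ← scalar_one, ← inv_mul_cancel₀ hk, ← scalar_mul, comp_assoc,
    scalar_coscalar hk, comp_id]

theorem scalar_cap {k : ℝ} (hk : k ≠ 0) :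
    (scalar k ⊗ 𝟙 1) ≫ cap = (𝟙 1 ⊗ scalar k⁻¹) ≫ cap := by
  have e := slide_comm cap (scalar k ⊗ 𝟙 1)
  rw [show (𝟙 0 ⊗ (scalar k ⊗ 𝟙 1) : Mor 2 2) = scalar k ⊗ 𝟙 1 from
    empty_tensor (scalar k ⊗ 𝟙 1)] at e
  have e' : (𝟙 1 ⊗ (cup ⊗ 𝟙 1 : Mor 1 3)) ≫ (cap ⊗ 𝟙 2 : Mor 4 2) = 𝟙 2 := by
    have e₁ : (𝟙 1 ⊗ (cup ⊗ 𝟙 1 : Mor 1 3)) = (𝟙 1 ⊗ cup : Mor 1 3) ⊗ 𝟙 1 :=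
      (assoc₁₁ (𝟙 1) cup (𝟙 1)).symm
    rw [e₁, show 𝟙 2 = 𝟙 1 ⊗ 𝟙 1 from (id_tensor_id 1 1).symm, ← assoc₁₁ cap, ← comp_tensor_id,
      snake']
  rw [← coscalar_eq hk, coscalar, id_tensor_comp, id_tensor_comp, comp_assoc, comp_assoc,
    ← id_two_tensor₂₀, ← cap_cap, assoc₁₁, ← id_two_tensor₂₂,
    reassoc e.symm, comp_assoc, reassoc e', id_comp]

theorem source_add (a : Mor 0 1) :
    (𝟙 1 ⊗ a : Mor 1 2) ≫ add = (a ⊗ 𝟙 1 : Mor 1 2) ≫ add := by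
  have e : (a ⊗ 𝟙 1) ≫ cross = swap 0 1 ≫ (𝟙 1 ⊗ a) := swap_natural _ _
  rw [swap_zero_one] at e
  have e' : (𝟙 1 ⊗ a : Mor 1 2) = (a ⊗ 𝟙 1 : Mor 1 2) ≫ cross := (id_comp _).symm.trans e.symm
  rw [e', comp_assoc, add_comm]

theorem add_zero : (𝟙 1 ⊗ zero : Mor 1 2) ≫ add = 𝟙 1 := by
  rw [source_add, zero_add]

/-- The white counit compares a wire with zero. -/
theorem wcounit_eq : (𝟙 1 ⊗ zero : Mor 1 2) ≫ cap = wcounit := by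
  rw [← id_comp wcounit, ← add_zero, comp_assoc, white_cap, ← comp_assoc, ← id_tensor_comp,
    zero_scalar, add_zero]

theorem scalar_wcounit {k : ℝ} (hk : k ≠ 0) : scalar k ≫ wcounit = wcounit := by
  have e : scalar k ≫ (𝟙 1 ⊗ zero : Mor 1 2) = (𝟙 1 ⊗ zero : Mor 1 2) ≫ (scalar k ⊗ 𝟙 1) :=
    (tensor_source _ _).symm.trans (slide' _ _).symm
  rw [← wcounit_eq, reassoc e, comp_assoc, scalar_cap hk, ← comp_assoc, ← id_tensor_comp,
    zero_scalar]

theorem bunit_wcounit : bunit ≫ wcounit = 𝟙 0 := by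
  rw [← wcounit_eq, ← comp_assoc, ← tensor_source, source_tensor, comp_assoc, cap,
    reassoc bunit_bmul, id_comp, zero_discard]

/-- Conditioning on `b * y + r = 0` means conditioning on `y = -b⁻¹ * r`. -/
theorem shear₁_wcounit {b : ℝ} (hb : b ≠ 0) :
    shear₁ b ≫ (𝟙 1 ⊗ wcounit) = (𝟙 1 ⊗ scalar (-b⁻¹)) ≫ bmul := by
  have h : mulAdd b ≫ wcounit = (𝟙 1 ⊗ scalar (-b⁻¹)) ≫ cap := by
    rw [mulAdd, comp_assoc, white_cap, ← comp_assoc, slide_comm, comp_assoc, scalar_cap hb,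
      ← comp_assoc, ← id_tensor_comp, scalar_mul, neg_one_mul]
  rw [shear₁, comp_assoc, ← id_tensor_comp, h, id_tensor_comp, bmul_eq, ← id_two_tensor₁₁,
    ← comp_assoc, slide_comm, comp_assoc]

/-- The white counterpart of `cup`: two wires whose sum is zero. -/
def cocap : Mor 0 2 := cup ≫ (𝟙 1 ⊗ scalar (-1))

theorem cocap_snake :
    (𝟙 1 ⊗ cocap : Mor 1 3) ≫ ((add ≫ wcounit) ⊗ 𝟙 1) = 𝟙 1 := by
  have h : (𝟙 1 ⊗ scalar (-1)) ≫ cap = (scalar (-1) ⊗ 𝟙 1) ≫ cap := by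
    rw [scalar_cap (by norm_num), inv_neg_one]
  rw [white_cap, h, cocap, id_tensor_comp, comp_tensor_id, comp_assoc]
  generalize hs : scalar (-1) = s
  have e₁ : (𝟙 1 ⊗ (𝟙 1 ⊗ s)) ≫ (s ⊗ 𝟙 1 ⊗ 𝟙 1) = (s ⊗ 𝟙 2) ≫ (𝟙 2 ⊗ s) := by
    rw [← assoc₁₁, id_tensor_id, ← slide_comm, assoc₁₁, id_tensor_id]
  have e₂ : (𝟙 2 ⊗ s) ≫ (cap ⊗ 𝟙 1 : Mor 3 1) = (cap ⊗ 𝟙 1 : Mor 3 1) ≫ s := by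
    have e := slide_comm cap s
    rw [show (𝟙 0 ⊗ s : Mor 1 1) = s from empty_tensor s] at e
    exact e.symm
  have e₃ : (𝟙 1 ⊗ cup : Mor 1 3) ≫ (s ⊗ 𝟙 2) = s ≫ (𝟙 1 ⊗ cup : Mor 1 3) :=
    (slide' s cup).trans (tensor_source s cup)
  rw [reassoc e₁, comp_assoc, e₂, reassoc e₃, comp_assoc, reassoc snake', id_comp, ← hs,
    scalar_mul, neg_mul_neg, one_mul, scalar_one]

theorem cocap_add : cocap ≫ add = zero := by
  rw [cocap, cup, comp_assoc, comp_assoc, ← scalar_one, scalar_add, add_neg_cancel, scalar_zero,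
    ← comp_assoc, black_bone, id_comp]

/-- The white comultiplication is expressed by `add`, scalars and the black unit. -/
theorem wcomul_eq : wcomul = (𝟙 1 ⊗ cocap : Mor 1 3) ≫ (add ⊗ 𝟙 1) := by
  -- `W` is inverse to the pairing `add ≫ wcounit` up to the map `Q`; the special law forces `Q` to
  -- be the identity.
  obtain ⟨W, hW⟩ : ∃ W, W = zero ≫ wcomul := ⟨_, rfl⟩
  obtain ⟨Q, hQ⟩ : ∃ Q : Mor 1 1, Q = wcomul ≫ (𝟙 1 ⊗ wcounit) := ⟨_, rfl⟩
  obtain ⟨t, ht⟩ : ∃ t : Mor 0 1, t = W ≫ (𝟙 1 ⊗ wcounit) := ⟨_, rfl⟩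
  have h₁ : wcomul = (𝟙 1 ⊗ W : Mor 1 3) ≫ (add ⊗ 𝟙 1) := by
    rw [hW, id_tensor_comp, comp_assoc, white_frobenius_right, reassoc add_zero, id_comp]
  have h₂ : (W ⊗ 𝟙 1 : Mor 1 3) ≫ (𝟙 1 ⊗ (add ≫ wcounit)) = Q := by
    rw [hW, comp_tensor_id, id_tensor_comp, comp_assoc, reassoc white_frobenius_left, comp_assoc,
      reassoc zero_add, id_comp, hQ]
  have h₃ : Q = (𝟙 1 ⊗ t : Mor 1 2) ≫ add := by
    have e := slide_comm add wcounit
    rw [show (add ⊗ 𝟙 0 : Mor 2 1) = add from tensor_empty add,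
      show 𝟙 2 = 𝟙 1 ⊗ 𝟙 1 from (id_tensor_id 1 1).symm, assoc₁₀] at e
    rw [hQ, h₁, comp_assoc, e, ht, id_tensor_comp, comp_assoc]
  have h₄ : W = cocap ≫ (Q ⊗ 𝟙 1) := by
    have e₁ : W ≫ (𝟙 1 ⊗ (𝟙 1 ⊗ cocap : Mor 1 3)) = cocap ≫ (W ⊗ 𝟙 2 : Mor 2 4) := by
      have e₂ := slide_comm W cocap
      rw [show (𝟙 0 ⊗ cocap : Mor 0 2) = cocap from empty_tensor cocap,
        show (W ⊗ 𝟙 0 : Mor 0 2) = W from tensor_empty W] at e₂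
      rw [← assoc₀₂, id_tensor_id]
      exact e₂
    have e₂ : (W ⊗ 𝟙 2 : Mor 2 4) = (W ⊗ 𝟙 1 : Mor 1 3) ⊗ 𝟙 1 := by
      rw [show 𝟙 2 = 𝟙 1 ⊗ 𝟙 1 from (id_tensor_id 1 1).symm, ← assoc₁₁]
    have e₃ : W = W ≫ (𝟙 1 ⊗ ((𝟙 1 ⊗ cocap : Mor 1 3) ≫ ((add ≫ wcounit) ⊗ 𝟙 1))) := by
      rw [cocap_snake, id_tensor_id]; exact (comp_id W).symm
    rw [e₃, id_tensor_comp, reassoc e₁, comp_assoc, e₂, ← assoc₁₁,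
      ← comp_tensor_id, h₂]
  have h₅ : t = zero := by
    have e : W ≫ add = zero := by rw [hW, comp_assoc, white_special, comp_id]
    have e₁ := slide_comm add t
    rw [show (add ⊗ 𝟙 0 : Mor 2 1) = add from tensor_empty add] at e₁
    have e₂ : (((𝟙 1 ⊗ t : Mor 1 2) ≫ add) ⊗ 𝟙 1) ≫ add = add ≫ (𝟙 1 ⊗ t : Mor 1 2) ≫ add := by
      rw [comp_tensor_id, comp_assoc, add_assoc, assoc₁₁, ← comp_assoc, ← id_tensor_comp,
        ← source_add, id_tensor_comp, comp_assoc, ← add_assoc, ← assoc₀₁, id_tensor_id,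
        reassoc e₁, comp_assoc]
    rw [h₄, h₃, comp_assoc, e₂, reassoc cocap_add, ← comp_assoc, ← tensor_source, source_tensor,
      comp_assoc, zero_add] at e
    exact (comp_id t).symm.trans e
  rw [h₅, add_zero] at h₃
  rw [h₁, h₄, h₃, id_tensor_id, comp_id]

/-- The scalar with value `c ^ 2 / 2`. -/
def cost (c : ℝ) : Mor 0 0 := const c ≫ (gauss ⊗ 𝟙 1 : Mor 1 2) ≫ cap

/-- The scalar with value `∞`. -/
def infinity : Mor 0 0 := one ≫ wcounit

theorem scalar_tensor (α : Mor 0 0) (a : Mor 0 1) : (α ⊗ a : Mor 0 1) = α ≫ a := by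
  have e := slide α a
  rw [show (𝟙 0 ⊗ a : Mor 0 1) = a from empty_tensor a,
    show (α ⊗ 𝟙 0 : Mor 0 0) = α from tensor_empty α] at e
  exact e.symm

/-- In the presence of `infinity` every wire is an unconstrained one. -/
theorem infinity_absorb (a : Mor 0 1) : infinity ≫ a = infinity ≫ a ≫ discard ≫ bunit := by
  have h : infinity ⊗ 𝟙 1 = infinity ⊗ (discard ≫ bunit) :=
    mk_eq_iff.2 (.ax .infinity_disconnect)
  have e₁ (a : Mor 0 1) : infinity ≫ a = a ≫ (infinity ⊗ 𝟙 1 : Mor 1 1) :=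
    (scalar_tensor _ _).symm.trans (source_tensor _ _)
  have e₂ : (infinity ⊗ 𝟙 1 : Mor 1 1) = (infinity ⊗ 𝟙 1 : Mor 1 1) ≫ (discard ≫ bunit) := by
    have e := slide infinity (discard ≫ bunit)
    rw [show (𝟙 0 ⊗ (discard ≫ bunit) : Mor 1 1) = _ from empty_tensor (discard ≫ bunit), ← h] at e
    exact e.symm
  rw [e₁, e₂, ← comp_assoc, ← e₁, comp_assoc]

theorem const_copy (c : ℝ) : const c ≫ copy = const c ⊗ const c := by
  rw [const, interchange, ← one_copy, comp_assoc, comp_assoc, scalar_copy]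

theorem const_discard (c : ℝ) : const c ≫ discard = 𝟙 0 := by
  rw [const, comp_assoc, scalar_discard, one_discard]

theorem const_zero : const 0 = zero := by
  rw [const, scalar_zero, ← comp_assoc, one_discard, id_comp]

theorem const_scalar (c k : ℝ) : const c ≫ scalar k = const (c * k) := by
  rw [const, comp_assoc, scalar_mul, const]

theorem const_wcounit {c : ℝ} (hc : c ≠ 0) : const c ≫ wcounit = infinity := by
  rw [const, comp_assoc, scalar_wcounit hc, infinity]

theorem cost_zero : cost 0 = 𝟙 0 := by
  rw [cost, const_zero, ← comp_assoc, ← source_tensor, tensor_source, comp_assoc, wcounit_eq,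
    gauss_wcounit]

/-- Comparing a standard Gaussian with the constant `c` yields this constant, at its cost. -/
theorem gauss_const_bmul (c : ℝ) : (gauss ⊗ const c : Mor 0 2) ≫ bmul = cost c ≫ const c := by
  have e₁ : (gauss ⊗ const c : Mor 0 2) ≫ (𝟙 1 ⊗ copy) = (gauss ⊗ const c : Mor 0 2) ⊗ const c := by
    rw [← interchange, const_copy, comp_id, ← assoc₀₁]
  have e₂ : (gauss ⊗ const c : Mor 0 2) ≫ cap = cost c := by
    rw [source_tensor, comp_assoc, cost]
  rw [bmul_eq', reassoc e₁, ← interchange, e₂, comp_id]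
  exact scalar_tensor _ _

theorem scalar_comm (x y : Mor 0 0) : x ≫ y = y ≫ x := by
  have e₁ := slide x y
  have e₂ := slide' x y
  rw [show (𝟙 0 ⊗ y : Mor 0 0) = y from empty_tensor y,
    show (x ⊗ 𝟙 0 : Mor 0 0) = x from tensor_empty x] at e₁ e₂
  exact e₁.trans e₂.symm

theorem infinity_comp_cost (c : ℝ) : infinity ≫ cost c = infinity := by
  have e : bunit ≫ (gauss ⊗ 𝟙 1 : Mor 1 2) ≫ cap = 𝟙 0 := by
    rw [← comp_assoc, ← source_tensor, tensor_source, cap, comp_assoc, reassoc bmul_bunit, id_comp,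
      gauss_discard]
  rw [cost, ← comp_assoc, infinity_absorb, reassoc (const_discard c), id_comp, comp_assoc, e,
    comp_id]

theorem infinity_comp_infinity : infinity ≫ infinity = infinity := by
  nth_rewrite 2 [infinity]
  rw [← comp_assoc, infinity_absorb, reassoc one_discard, id_comp, comp_assoc, bunit_wcounit,
    comp_id]

/-! ### Conditioning on functionals -/

/-- Conditioning `n` wires on the event that the functional `a` vanishes. -/
def filter (a : Functional n) : Mor n n :=
  (𝟙 n ⊗ zero : Mor n (n + 1)) ≫ shear a ≫ (𝟙 n ⊗ wcounit : Mor (n + 1) n)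

/-- Conditions on the outputs of `f` become conditions on its inputs. -/
theorem Pull.comp_filter {f : Mor m n} {a : Functional n} {a' : Functional m} (h : Pull f a a') :
    f ≫ filter a = filter a' ≫ f := by
  have e₁ : f ≫ (𝟙 n ⊗ zero : Mor n (n + 1)) = (𝟙 m ⊗ zero : Mor m (m + 1)) ≫ (f ⊗ 𝟙 1) :=
    (tensor_source _ _).symm.trans (slide' _ _).symm
  have e₂ : (f ⊗ 𝟙 1) ≫ (𝟙 n ⊗ wcounit : Mor (n + 1) n) =
      (𝟙 m ⊗ wcounit : Mor (m + 1) m) ≫ f := by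
    have e := slide_comm f wcounit
    rw [show (f ⊗ 𝟙 0 : Mor m n) = f from tensor_empty f] at e
    exact e
  rw [filter, filter, reassoc e₁, comp_assoc, ← comp_assoc (f ⊗ 𝟙 1), h, comp_assoc, e₂,
    comp_assoc, comp_assoc]

theorem source_cross (a : Mor 0 1) : (𝟙 1 ⊗ a : Mor 1 2) ≫ cross = (a ⊗ 𝟙 1 : Mor 1 2) := by
  have e : (𝟙 1 ⊗ a) ≫ cross = swap 1 0 ≫ (a ⊗ 𝟙 1) := swap_natural _ _
  rw [swap_one_zero] at e
  exact e.trans (id_comp _)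

theorem cross_sink (a : Mor 1 0) : cross ≫ (𝟙 1 ⊗ a : Mor 2 1) = (a ⊗ 𝟙 1 : Mor 2 1) := by
  have e : (a ⊗ 𝟙 1) ≫ swap 0 1 = cross ≫ (𝟙 1 ⊗ a) := swap_natural _ _
  rw [swap_zero_one] at e
  exact e.symm.trans (comp_id _)

theorem id_succ_tensor₀₁ (f : Mor 0 1) : 𝟙 (n + 1) ⊗ f = 𝟙 n ⊗ (𝟙 1 ⊗ f) := by
  rw [← id_tensor_id, assoc₀₁]

theorem id_succ_tensor₁₀ (f : Mor 1 0) : 𝟙 (n + 1) ⊗ f = 𝟙 n ⊗ (𝟙 1 ⊗ f) := by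
  rw [← id_tensor_id, assoc₁₀]

theorem filter_snoc_zero (a : Functional n) : filter (a.snoc 0) = filter a ⊗ 𝟙 1 := by
  have e₁ : (𝟙 (n + 1) ⊗ zero : Mor (n + 1) (n + 2)) ≫ (𝟙 n ⊗ cross) =
      (𝟙 n ⊗ zero : Mor n (n + 1)) ⊗ 𝟙 1 := by
    rw [source_tensor_id, ← source_cross, id_tensor_comp, id_succ_tensor₀₁]
  have e₂ : (𝟙 n ⊗ cross) ≫ (𝟙 (n + 1) ⊗ wcounit : Mor (n + 2) (n + 1)) =
      (𝟙 n ⊗ wcounit : Mor (n + 1) n) ⊗ 𝟙 1 := by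
    rw [sink_tensor_id, ← cross_sink, id_tensor_comp, id_succ_tensor₁₀]
  rw [filter, filter, shear, shear₁_zero, id_tensor_id, comp_id, lift, comp_assoc, reassoc e₁,
    comp_assoc, e₂, ← comp_tensor_id, ← comp_tensor_id]

/-- The last of several independent wires meets a condition only in the comparison with the value
`r` of the remaining terms of the functional. -/
theorem tensor_comp_filter_snoc (S : Mor 0 n) (s : Mor 0 1) (a : Functional n) (b : ℝ) :
    (S ⊗ s : Mor 0 (n + 1)) ≫ filter (a.snoc b) =
      S ≫ (𝟙 n ⊗ zero : Mor n (n + 1)) ≫ shear a ≫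
        (𝟙 n ⊗ ((s ⊗ 𝟙 1 : Mor 1 2) ≫ shear₁ b ≫ (𝟙 1 ⊗ wcounit : Mor 2 1))) := by
  have e₁ : (𝟙 n ⊗ s : Mor n (n + 1)) ≫ (𝟙 (n + 1) ⊗ zero : Mor (n + 1) (n + 2)) =
      (𝟙 n ⊗ zero : Mor n (n + 1)) ≫ (𝟙 n ⊗ (s ⊗ 𝟙 1 : Mor 1 2)) := by
    rw [id_succ_tensor₀₁]
    exact (id_tensor_comp n s (𝟙 1 ⊗ zero : Mor 1 2)).symm.trans
      ((congrArg (𝟙 n ⊗ ·) ((tensor_source s zero).symm.trans (source_tensor s zero))).trans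
        (id_tensor_comp n zero (s ⊗ 𝟙 1 : Mor 1 2)))
  rw [tensor_source, filter, shear, comp_assoc, reassoc e₁, comp_assoc, comp_assoc,
    ← comp_assoc (𝟙 n ⊗ (s ⊗ 𝟙 1 : Mor 1 2)), shear_source, comp_assoc, id_succ_tensor₁₀,
    id_tensor_comp, id_tensor_comp]

/-- A wire that does not occur in the condition is not affected by it. -/
theorem tensor_comp_filter_snoc_zero (S : Mor 0 n) (s : Mor 0 1) (a : Functional n) :
    (S ⊗ s : Mor 0 (n + 1)) ≫ filter (a.snoc 0) = (S ≫ filter a) ⊗ s := by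
  rw [filter_snoc_zero]
  exact (interchange _ _ _ _).symm.trans (by rw [comp_id])

theorem source_shear₁_wcounit (s : Mor 0 1) {b : ℝ} (hb : b ≠ 0) :
    (s ⊗ 𝟙 1 : Mor 1 2) ≫ shear₁ b ≫ (𝟙 1 ⊗ wcounit : Mor 2 1) =
      scalar (-b⁻¹) ≫ (s ⊗ 𝟙 1 : Mor 1 2) ≫ bmul := by
  rw [shear₁_wcounit hb, ← comp_assoc, ← comp_assoc, point_tensor]
  exact congrArg (· ≫ bmul) (slide s (scalar (-b⁻¹)))

/-- An unconstrained wire that occurs in the condition is determined by the other wires. -/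
theorem tensor_bunit_comp_filter (S : Mor 0 n) (a : Functional n) {b : ℝ} (hb : b ≠ 0) :
    (S ⊗ bunit : Mor 0 (n + 1)) ≫ filter (a.snoc b) =
      S ≫ (𝟙 n ⊗ zero : Mor n (n + 1)) ≫ shear a ≫ (𝟙 n ⊗ scalar (-b⁻¹)) := by
  rw [tensor_comp_filter_snoc, source_shear₁_wcounit _ hb, bunit_bmul, comp_id]

theorem zero_translate (c : ℝ) : zero ≫ translate c = const c := by
  rw [translate, ← comp_assoc, ← source_tensor, tensor_source, comp_assoc, add_zero, comp_id]

/-- Conditioning a standard Gaussian on its value costs half the square of that value. -/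
theorem gauss_comp_filter (c : ℝ) {b : ℝ} (hb : b ≠ 0) :
    gauss ≫ filter ((Functional.const c).snoc b) =
      cost (c * -b⁻¹) ≫ const (c * -b⁻¹) := by
  have e := tensor_comp_filter_snoc (𝟙 0) gauss (.const c) b
  rw [source_shear₁_wcounit _ hb] at e
  have e₁ : (𝟙 0 ⊗ gauss : Mor 0 1) = gauss := empty_tensor gauss
  have e₂ : (𝟙 0 ⊗ zero : Mor 0 1) = zero := empty_tensor zero
  have e₃ (f : Mor 1 1) : (𝟙 0 ⊗ f : Mor 1 1) = f := empty_tensor f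
  rw [e₁] at e
  refine e.trans ?_
  rw [id_comp, shear, e₂, e₃, ← comp_assoc zero, zero_translate, ← comp_assoc, const_scalar,
    ← comp_assoc, ← source_tensor, gauss_const_bmul]

/-- The morphism of the matrix `!![a, b; c, d]`. -/
def matrix (a b c d : ℝ) : Mor 2 2 :=
  (copy ⊗ copy) ≫ (scalar a ⊗ scalar c ⊗ (scalar b ⊗ scalar d)) ≫
    (𝟙 1 ⊗ cross ⊗ 𝟙 1) ≫ (add ⊗ add)

/-- Two independent standard Gaussians are invariant under rotations. -/
theorem gauss_rotation {c s : ℝ} (h : c ^ 2 + s ^ 2 = 1) :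
    (gauss ⊗ gauss : Mor 0 2) ≫ matrix c (-s) s c = gauss ⊗ gauss := by
  obtain ⟨φ, h₀, h₁, rfl, rfl⟩ :
      ∃ φ, 0 ≤ φ ∧ φ < 2 * Real.pi ∧ c = Real.cos φ ∧ s = Real.sin φ := by
    have hz : ‖(⟨c, s⟩ : ℂ)‖ = 1 := by
      rw [Complex.norm_def, Complex.normSq_mk, ← sq, ← sq, h, Real.sqrt_one]
    have hc : Real.cos (Complex.arg ⟨c, s⟩) = c := by
      rw [Complex.cos_arg (norm_ne_zero_iff.1 (hz ▸ one_ne_zero)), hz, div_one]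
    have hs : Real.sin (Complex.arg ⟨c, s⟩) = s := by
      rw [Complex.sin_arg, hz, div_one]
    have hl := Complex.neg_pi_lt_arg ⟨c, s⟩
    have hu := Complex.arg_le_pi ⟨c, s⟩
    have hπ := Real.pi_pos
    rcases le_or_gt 0 (Complex.arg ⟨c, s⟩) with h₀ | h₀
    · exact ⟨_, h₀, by linarith, hc.symm, hs.symm⟩
    · refine ⟨Complex.arg ⟨c, s⟩ + 2 * Real.pi, by linarith, by linarith, ?_, ?_⟩
      · rw [Real.cos_add_two_pi, hc]
      · rw [Real.sin_add_two_pi, hs]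
  have e := mk_eq_iff.2 (.ax (.gauss_rotation φ h₀ h₁))
  rw [matrix, ← comp_assoc (copy ⊗ copy), ← comp_assoc (_ ≫ _)]
  exact e

theorem matrix_discard (a b c d : ℝ) :
    matrix a b c d ≫ (discard ⊗ discard : Mor 2 0) = (discard ⊗ discard : Mor 2 0) := by
  have e₁ : cross ≫ (discard ⊗ discard : Mor 2 0) = discard ⊗ discard := by
    have e : (discard ⊗ discard) ≫ swap 0 0 = cross ≫ (discard ⊗ discard) := swap_natural _ _
    rw [swap_zero_zero] at e
    exact e.symm.trans (comp_id _)
  have e₂ : copy ≫ (discard ⊗ discard : Mor 2 0) = discard := by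
    have e := slide discard discard
    rw [show (𝟙 0 ⊗ discard : Mor 1 0) = discard from empty_tensor discard] at e
    rw [← e, reassoc copy_discard, id_comp]
  have e₃ : (discard ⊗ discard : Mor 2 0) ⊗ (discard ⊗ discard : Mor 2 0) =
      discard ⊗ (discard ⊗ discard) ⊗ discard := by
    rw [← assoc₁₀, ← assoc₁₀]
  rw [matrix, comp_assoc, comp_assoc, comp_assoc, ← interchange, add_discard, e₃, ← interchange,
    ← interchange, e₁, id_comp, ← e₃, ← interchange, ← interchange, ← interchange,
    ← interchange]
  simp only [scalar_discard]
  rw [e₂]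

theorem Pull.tensor_scalar {f : Mor m n} {a : Functional n} {a' : Functional m} (h : Pull f a a')
    (k b : ℝ) : Pull (f ⊗ scalar k) (a.snoc b) (a'.snoc (k * b)) :=
  slide f (scalar k) ▸ (h.tensor_id _).comp (pull_scalar a k b)

theorem Pull.tensor_add {f : Mor m n} {a : Functional n} {a' : Functional m} (h : Pull f a a')
    (b : ℝ) : Pull (f ⊗ add) (a.snoc b) ((a'.snoc b).snoc b) := by
  rw [← slide f add, show 𝟙 2 = 𝟙 1 ⊗ 𝟙 1 from (id_tensor_id 1 1).symm, ← assoc₁₁]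
  exact ((h.tensor_id b).tensor_id b).comp (pull_add a b)

theorem Pull.tensor_copy {f : Mor m n} {a : Functional n} {a' : Functional m} (h : Pull f a a')
    (b₁ b₂ : ℝ) : Pull (f ⊗ copy) ((a.snoc b₁).snoc b₂) (a'.snoc (b₁ + b₂)) :=
  slide f copy ▸ (h.tensor_id _).comp (pull_copy a b₁ b₂)

theorem pull_matrix (A : Functional p) (a b c d b₁ b₂ : ℝ) :
    Pull (𝟙 p ⊗ matrix a b c d) ((A.snoc b₁).snoc b₂)
      ((A.snoc (a * b₁ + c * b₂)).snoc (b * b₁ + d * b₂)) := by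
  have h₁ := ((pull_id A).tensor_copy (a * b₁) (c * b₂)).tensor_copy (b * b₁) (d * b₂)
  have h₂ := ((((pull_id A).tensor_scalar a b₁).tensor_scalar c b₂).tensor_scalar b
    b₁).tensor_scalar d b₂
  have h₃ := (pull_cross (A.snoc b₁) b₁ b₂).tensor_id b₂
  have h₄ := ((pull_id A).tensor_add b₁).tensor_add b₂
  rw [← id_tensor_id, assoc₂₂, assoc₁₁] at h₃
  rw [assoc₂₁] at h₄
  rw [assoc₁₁ _ (scalar b), assoc₁₁ (𝟙 p), assoc₂₂] at h₂
  rw [assoc₁₂] at h₁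
  rw [matrix, id_tensor_comp, id_tensor_comp, id_tensor_comp]
  exact h₁.comp (h₂.comp (h₃.comp h₄))

theorem pull_const (c d b : ℝ) :
    Pull (const c) ((Functional.const d).snoc b) (.const (d + c * b)) := by
  have h := (pull_one (.const d) (c * b)).comp (pull_scalar (.const d) c b)
  have e : (𝟙 0 ⊗ one : Mor 0 1) ≫ (𝟙 0 ⊗ scalar c : Mor 1 1) = const c :=
    congrArg₂ (fun (x : Mor 0 1) (y : Mor 1 1) => x ≫ y) (empty_tensor one)
      (empty_tensor (scalar c))
  rw [← e]
  exact h

theorem pull_translate (c d : ℝ) :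
    Pull (translate c) ((Functional.const d).snoc 0) ((Functional.const d).snoc 0) := by
  have h := pull_add (.const d) 0
  rw [show (𝟙 0 ⊗ add : Mor 2 1) = add from empty_tensor add] at h
  have h' := (pull_const c d 0).tensor_id 0
  rw [mul_zero, _root_.add_zero] at h'
  exact h'.comp h

/-- Adding `a` to a further wire does not change the first wire, on which `b` depends. -/
theorem pull_shear_self (a b : Functional 1) : Pull (shear a) (b.snoc 0) (b.snoc 0) := by
  obtain ⟨c, x, rfl⟩ : ∃ c x, a = (Functional.const c).snoc x :=
    match a with | .snoc (.const c) x => ⟨c, x, rfl⟩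
  obtain ⟨d, y, rfl⟩ : ∃ d y, b = (Functional.const d).snoc y :=
    match b with | .snoc (.const d) y => ⟨d, y, rfl⟩
  have h₁ := pull_cross (.const d) 0 y
  have h₂ := (pull_translate c d).tensor_id y
  have h₃ := pull_cross (.const d) y 0
  have h₄ := (pull_id (.const d)).tensor_copy y (x * 0) |>.tensor_id 0
  have h₅ := (pull_id ((Functional.const d).snoc y)).tensor_scalar x 0 |>.tensor_id 0
  have h₆ := pull_add ((Functional.const d).snoc y) 0
  have e : 𝟙 0 ⊗ shear₁ x = (𝟙 0 ⊗ copy ⊗ 𝟙 1) ≫ (𝟙 1 ⊗ scalar x ⊗ 𝟙 1) ≫ (𝟙 1 ⊗ add) := by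
    rw [shear₁, mulAdd, id_tensor_comp, id_tensor_comp, id_tensor_comp, assoc₁₁ (𝟙 0),
      assoc₁₁ (𝟙 1), ← assoc₂₂, ← assoc₂₁, id_tensor_id]
  rw [mul_zero, _root_.add_zero] at h₄
  rw [mul_zero] at h₅
  exact (h₁.comp (h₂.comp h₃)).comp (e ▸ h₄.comp (h₅.comp h₆))

/-- Conditioning a wire preserves the functionals on it, so that two conditions commute. -/
theorem pull_filter_self (a b : Functional 1) : Pull (filter a) b b :=
  (pull_zero b 0).comp ((pull_shear_self a b).comp (pull_of_sink wcounit b))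

theorem scalar_comp_tensor (α : Mor 0 0) (X : Mor 0 n) (s : Mor 0 1) :
    ((α ≫ X) ⊗ s : Mor 0 (n + 1)) = α ≫ (X ⊗ s : Mor 0 (n + 1)) := by
  have e := interchange α X (𝟙 0) s
  rw [id_comp, show (α ⊗ 𝟙 0 : Mor 0 0) = α from tensor_empty α] at e
  exact e

theorem source_discard_discard {s : Mor 0 1} (hs : s ≫ discard = 𝟙 0) (t : Mor 0 1) :
    t ≫ (s ⊗ 𝟙 1 : Mor 1 2) ≫ (discard ⊗ discard : Mor 2 0) = t ≫ discard := by
  have e := interchange s discard (𝟙 1) discard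
  rw [hs, id_comp, show (𝟙 0 ⊗ discard : Mor 1 0) = discard from empty_tensor discard] at e
  exact congrArg (t ≫ ·) e.symm

/-- Costs add up. The values `c` and `d` of two standard Gaussians can be imposed by the conditions
`y₁ = c` and `d * y₁ = c * y₂`. If the second condition is imposed first, a rotation reduces it to
the vanishing of one of the Gaussians. -/
theorem cost_comp_cost {c : ℝ} (hc : c ≠ 0) (d : ℝ) :
    cost c ≫ cost d = cost (Real.sqrt (c ^ 2 + d ^ 2)) := by
  obtain ⟨h, hh⟩ : ∃ h, h = Real.sqrt (c ^ 2 + d ^ 2) := ⟨_, rfl⟩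
  have hpos : 0 < c ^ 2 + d ^ 2 := by positivity
  have hh₀ : h ≠ 0 := hh ▸ (Real.sqrt_pos.2 hpos).ne'
  have hsq : h ^ 2 = c ^ 2 + d ^ 2 := hh ▸ Real.sq_sqrt hpos.le
  rw [← hh]
  obtain ⟨a, ha⟩ : ∃ a, a = (Functional.const (-c)).snoc 1 := ⟨_, rfl⟩
  obtain ⟨ρ, hρ⟩ : ∃ ρ, ρ = ((Functional.const 0).snoc d).snoc (-c) := ⟨_, rfl⟩
  have comm : filter (a.snoc 0) ≫ filter ρ = filter ρ ≫ filter (a.snoc 0) := by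
    rw [filter_snoc_zero]
    exact Pull.comp_filter (hρ ▸ (pull_filter_self a _).tensor_id _)
  have first : (gauss ⊗ gauss : Mor 0 2) ≫ filter (a.snoc 0) ≫ filter ρ ≫
      (discard ⊗ discard : Mor 2 0) = cost c ≫ cost d := by
    have e₁ : (gauss ⊗ gauss : Mor 0 2) ≫ filter (a.snoc 0) =
        cost c ≫ (const c ⊗ gauss : Mor 0 2) := by
      have e₂ := gauss_comp_filter (-c) one_ne_zero
      rw [inv_one, neg_mul_neg, mul_one, ← ha] at e₂
      rw [← scalar_comp_tensor, ← e₂]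
      exact tensor_comp_filter_snoc_zero gauss gauss a
    have e₂ := ((pull_const c 0 d).tensor_id (-c)).comp_filter
    have e₃ := gauss_comp_filter (0 + c * d) (neg_ne_zero.2 hc)
    rw [show (0 + c * d) * -(-c)⁻¹ = d by field_simp; ring] at e₃
    rw [reassoc e₁, source_tensor, comp_assoc, comp_assoc, hρ, reassoc e₂, comp_assoc,
      reassoc e₃, comp_assoc, source_discard_discard (const_discard c), const_discard, comp_id]
  have second : (gauss ⊗ gauss : Mor 0 2) ≫ filter ρ ≫ filter (a.snoc 0) ≫
      (discard ⊗ discard : Mor 2 0) = cost h := by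
    obtain ⟨R, hR⟩ : ∃ R, R = matrix (c / h) (-(d / h)) (d / h) (c / h) := ⟨_, rfl⟩
    have e₁ : (gauss ⊗ gauss : Mor 0 2) ≫ R = gauss ⊗ gauss := by
      rw [hR]
      exact gauss_rotation (by field_simp; exact hsq.symm)
    have hpull (b₀ b₁ b₂ : ℝ) : Pull R (((Functional.const b₀).snoc b₁).snoc b₂)
        (((Functional.const b₀).snoc (c / h * b₁ + d / h * b₂)).snoc
          (-(d / h) * b₁ + c / h * b₂)) := by
      have := pull_matrix (.const b₀) (c / h) (-(d / h)) (d / h) (c / h) b₁ b₂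
      rw [← hR, show (𝟙 0 ⊗ R : Mor 2 2) = R from empty_tensor R] at this
      exact this
    have e₂ := (hpull 0 d (-c)).comp_filter
    rw [← hρ, show c / h * d + d / h * -c = 0 by ring,
      show -(d / h) * d + c / h * -c = -h by field_simp; linarith] at e₂
    have e₃ : (gauss ⊗ gauss : Mor 0 2) ≫ filter (((Functional.const 0).snoc 0).snoc (-h)) =
        gauss ≫ (𝟙 1 ⊗ zero : Mor 1 2) := by
      have e : zero ≫ scalar (-(-h)⁻¹) ≫ (gauss ⊗ 𝟙 1 : Mor 1 2) ≫ bmul = zero := by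
        rw [← comp_assoc, zero_scalar, ← comp_assoc, ← source_tensor, ← const_zero,
          gauss_const_bmul, cost_zero, id_comp]
      have e' := tensor_comp_filter_snoc gauss gauss (.zero 1) (-h)
      rw [source_shear₁_wcounit _ (neg_ne_zero.2 hh₀), shear_zero, id_comp] at e'
      exact e'.trans (congrArg (gauss ≫ ·) ((id_tensor_comp 1 zero _).symm.trans
        (congrArg (𝟙 1 ⊗ ·) e)))
    have e₄ := (hpull (-c) 1 0).comp_filter
    rw [mul_zero, mul_one, _root_.add_zero, ← ha] at e₄
    have e₅ := gauss_comp_filter (-c) (div_ne_zero hc hh₀)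
    rw [show -c * -(c / h)⁻¹ = h by field_simp] at e₅
    have e₆ := (pull_zero ((Functional.const (-c)).snoc (c / h))
      (-(d / h) * 1 + c / h * 0)).comp_filter
    have e₇ : (𝟙 1 ⊗ zero : Mor 1 2) ≫ (discard ⊗ discard : Mor 2 0) = discard := by
      have e := interchange (𝟙 1) discard zero discard
      rw [id_comp, zero_discard, show (discard ⊗ 𝟙 0 : Mor 1 0) = discard from
        tensor_empty discard] at e
      exact e.symm
    rw [← e₁, comp_assoc, reassoc e₂, comp_assoc, reassoc e₃, comp_assoc, reassoc e₄,
      comp_assoc, hR, matrix_discard, reassoc e₆, comp_assoc, reassoc e₅, comp_assoc, e₇,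
      const_discard, comp_id]
  rw [← first, ← second, reassoc comm, comp_assoc]

/-- Costs are invariant under sign changes: both are the sum with the cost of zero. -/
theorem cost_abs (c : ℝ) : cost c = cost |c| := by
  rcases eq_or_ne c 0 with rfl | hc
  · rw [abs_zero]
  · rw [← comp_id (cost c), ← cost_zero, cost_comp_cost hc]
    rw [zero_pow two_ne_zero, _root_.add_zero, Real.sqrt_sq_eq_abs]

/-! ### Normal forms -/

theorem affine_copy : Uses Gen.IsAffine copy := .gen trivial
theorem affine_discard : Uses Gen.IsAffine discard := .gen trivial
theorem affine_add : Uses Gen.IsAffine add := .gen trivial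
theorem affine_zero : Uses Gen.IsAffine zero := .gen trivial
theorem affine_scalar (k : ℝ) : Uses Gen.IsAffine (scalar k) := .gen trivial
theorem affine_one : Uses Gen.IsAffine one := .gen trivial
theorem affine_cross : Uses Gen.IsAffine cross := uses_swap 1 1

theorem affine_const (c : ℝ) : Uses Gen.IsAffine (const c) := affine_one.comp (affine_scalar c)

theorem affine_shear (a : Functional n) : Uses Gen.IsAffine (shear a) := by
  induction a with
  | const c => exact ((affine_const c).tensor (uses_id 1)).comp affine_add
  | @snoc j a b ih =>
    have h : Uses Gen.IsAffine (shear₁ b) := (affine_copy.tensor (uses_id 1)).comp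
      ((uses_id 1).tensor (((affine_scalar b).tensor (uses_id 1)).comp affine_add))
    have h' : Uses Gen.IsAffine (𝟙 j ⊗ cross) := (uses_id j).tensor affine_cross
    exact (h'.comp ((ih.tensor (uses_id 1)).comp h')).comp ((uses_id j).tensor h)

theorem affine_matrix (a b c d : ℝ) : Uses Gen.IsAffine (matrix a b c d) :=
  (affine_copy.tensor affine_copy).comp
    ((((affine_scalar a).tensor (affine_scalar c)).tensor
      ((affine_scalar b).tensor (affine_scalar d))).comp
    ((((uses_id 1).tensor affine_cross).tensor (uses_id 1)).comp (affine_add.tensor affine_add)))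

/-- Parallel composites of copies of `gauss` and `bunit`. -/
inductive IsSource : ∀ {n : ℕ}, Mor 0 n → Prop
  | nil : IsSource (𝟙 0)
  | gauss {n : ℕ} {S : Mor 0 n} (h : IsSource S) : IsSource (S ⊗ gauss : Mor 0 (n + 1))
  | bunit {n : ℕ} {S : Mor 0 n} (h : IsSource S) : IsSource (S ⊗ bunit : Mor 0 (n + 1))

/-- The scalars that occur in normal forms. Negative `c` are harmless, by `cost_abs`. -/
def IsScalar (α : Mor 0 0) : Prop := (∃ c, α = cost c) ∨ α = infinity

theorem isScalar_id : IsScalar (𝟙 0) := .inl ⟨0, cost_zero.symm⟩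

theorem IsScalar.comp {α β : Mor 0 0} (hα : IsScalar α) (hβ : IsScalar β) :
    IsScalar (α ≫ β) := by
  rcases hα with ⟨c, rfl⟩ | rfl <;> rcases hβ with ⟨d, rfl⟩ | rfl
  · rcases eq_or_ne c 0 with rfl | hc
    · exact .inl ⟨d, by rw [cost_zero, id_comp]⟩
    · exact .inl ⟨_, cost_comp_cost hc d⟩
  · exact .inr (by rw [scalar_comm, infinity_comp_cost])
  · exact .inr (infinity_comp_cost d)
  · exact .inr infinity_comp_infinity

/-- `D` is the product of a scalar with an affine image of independent Gaussians and unconstrained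
wires. -/
def HasNormalForm (D : Mor 0 n) : Prop :=
  ∃ (α : Mor 0 0) (k : ℕ) (S : Mor 0 k) (A : Mor k n),
    IsScalar α ∧ IsSource S ∧ Uses Gen.IsAffine A ∧ D = α ≫ S ≫ A

theorem IsSource.hasNormalForm_comp {S : Mor 0 k} (hS : IsSource S) {A : Mor k n}
    (hA : Uses Gen.IsAffine A) : HasNormalForm (S ≫ A) :=
  ⟨𝟙 0, k, S, A, isScalar_id, hS, hA, (id_comp _).symm⟩

namespace HasNormalForm

theorem comp {D : Mor 0 m} (hD : HasNormalForm D) {A : Mor m n} (hA : Uses Gen.IsAffine A) :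
    HasNormalForm (D ≫ A) := by
  obtain ⟨α, k, S, B, hα, hS, hB, rfl⟩ := hD
  exact ⟨α, k, S, B ≫ A, hα, hS, hB.comp hA, by rw [comp_assoc, comp_assoc]⟩

theorem scalar_comp {D : Mor 0 n} (hD : HasNormalForm D) {α : Mor 0 0} (hα : IsScalar α) :
    HasNormalForm (α ≫ D) := by
  obtain ⟨β, k, S, B, hβ, hS, hB, rfl⟩ := hD
  exact ⟨α ≫ β, k, S, B, hα.comp hβ, hS, hB, by rw [comp_assoc]⟩

theorem tensor {D : Mor 0 n} (hD : HasNormalForm D) {s : Mor 0 1}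
    (hs : ∀ {k : ℕ} {S : Mor 0 k}, IsSource S → IsSource (S ⊗ s : Mor 0 (k + 1))) :
    HasNormalForm (D ⊗ s : Mor 0 (n + 1)) := by
  obtain ⟨α, k, S, A, hα, hS, hA, rfl⟩ := hD
  refine ⟨α, k + 1, S ⊗ s, A ⊗ 𝟙 1, hα, hs hS, hA.tensor (uses_id 1), ?_⟩
  rw [scalar_comp_tensor]
  exact congrArg (α ≫ ·) ((congrArg _ (comp_id s).symm).trans (interchange S A s (𝟙 1)))

end HasNormalForm

/-- Every conditioning of `S` on the vanishing of a functional has a normal form. -/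
def CanCondition (S : Mor 0 n) : Prop := ∀ a : Functional n, HasNormalForm (S ≫ filter a)

/-- A condition that involves the unconstrained wire is solved for this wire. -/
theorem canCondition_tensor_bunit {S : Mor 0 n} (hS : IsSource S) (h : CanCondition S) :
    CanCondition (S ⊗ bunit : Mor 0 (n + 1)) := by
  rintro (_ | ⟨a, b⟩)
  rcases eq_or_ne b 0 with rfl | hb
  · rw [tensor_comp_filter_snoc_zero]
    exact (h a).tensor .bunit
  · rw [tensor_bunit_comp_filter _ _ hb]
    have h₁ : Uses Gen.IsAffine (𝟙 n ⊗ zero : Mor n (n + 1)) := (uses_id n).tensor affine_zero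
    exact hS.hasNormalForm_comp
      (h₁.comp ((affine_shear a).comp ((uses_id n).tensor (affine_scalar _))))

/-- Two Gaussians can be rotated such that the functional does not depend on the second one. -/
theorem canCondition_tensor_gauss_gauss {S : Mor 0 n}
    (h : CanCondition (S ⊗ gauss : Mor 0 (n + 1))) :
    CanCondition ((S ⊗ gauss : Mor 0 (n + 1)) ⊗ gauss : Mor 0 (n + 2)) := by
  intro a
  obtain ⟨a, b₁, b₂, rfl⟩ : ∃ a' b₁ b₂, a = (Functional.snoc a' b₁).snoc b₂ :=
    match a with | .snoc (.snoc a' b₁) b₂ => ⟨a', b₁, b₂, rfl⟩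
  rcases eq_or_ne b₂ 0 with rfl | hb
  · rw [tensor_comp_filter_snoc_zero]
    exact (h _).tensor .gauss
  · -- The rotation that turns the coefficient vector `(b₁, b₂)` into `(r, 0)`.
    obtain ⟨r, hr⟩ : ∃ r, r = Real.sqrt (b₁ ^ 2 + b₂ ^ 2) := ⟨_, rfl⟩
    have hpos : 0 < b₁ ^ 2 + b₂ ^ 2 := by positivity
    have hr₀ : r ≠ 0 := hr ▸ (Real.sqrt_pos.2 hpos).ne'
    have hsq : r ^ 2 = b₁ ^ 2 + b₂ ^ 2 := hr ▸ Real.sq_sqrt hpos.le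
    have e : ((S ⊗ gauss : Mor 0 (n + 1)) ⊗ gauss : Mor 0 (n + 2)) =
        ((S ⊗ gauss : Mor 0 (n + 1)) ⊗ gauss : Mor 0 (n + 2)) ≫
          (𝟙 n ⊗ matrix (b₁ / r) (-(b₂ / r)) (b₂ / r) (b₁ / r)) := by
      have e₁ := gauss_rotation (c := b₁ / r) (s := b₂ / r) (by field_simp; exact hsq.symm)
      have e₂ : ((S ⊗ gauss : Mor 0 (n + 1)) ⊗ gauss : Mor 0 (n + 2)) =
        S ⊗ (gauss ⊗ gauss : Mor 0 2) := assoc₀₁ S gauss gauss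
      have e₃ := interchange S (𝟙 n) (gauss ⊗ gauss : Mor 0 2)
        (matrix (b₁ / r) (-(b₂ / r)) (b₂ / r) (b₁ / r))
      rw [e₁, comp_id] at e₃
      rw [e₂]
      exact e₃
    have hp := (pull_matrix a (b₁ / r) (-(b₂ / r)) (b₂ / r) (b₁ / r) b₁ b₂).comp_filter
    rw [show -(b₂ / r) * b₁ + b₁ / r * b₂ = 0 by ring] at hp
    rw [e, comp_assoc, hp, ← comp_assoc, tensor_comp_filter_snoc_zero]
    exact ((h _).tensor .gauss).comp ((uses_id n).tensor (affine_matrix _ _ _ _))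

/-- The order of the last two wires does not matter. -/
theorem canCondition_tensor_bunit_gauss {S : Mor 0 n}
    (h : CanCondition ((S ⊗ gauss : Mor 0 (n + 1)) ⊗ bunit : Mor 0 (n + 2))) :
    CanCondition ((S ⊗ bunit : Mor 0 (n + 1)) ⊗ gauss : Mor 0 (n + 2)) := by
  intro a
  obtain ⟨a, b₁, b₂, rfl⟩ : ∃ a' b₁ b₂, a = (Functional.snoc a' b₁).snoc b₂ :=
    match a with | .snoc (.snoc a' b₁) b₂ => ⟨a', b₁, b₂, rfl⟩
  have e : ((S ⊗ bunit : Mor 0 (n + 1)) ⊗ gauss : Mor 0 (n + 2)) =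
      ((S ⊗ gauss : Mor 0 (n + 1)) ⊗ bunit : Mor 0 (n + 2)) ≫ (𝟙 n ⊗ cross) := by
    have e₁ : (gauss ⊗ bunit : Mor 0 2) ≫ cross = (bunit ⊗ gauss : Mor 0 2) := by
      have e := swap_natural gauss bunit
      rw [swap_zero_zero] at e
      exact e.trans (id_comp _)
    have e₂ := interchange S (𝟙 n) (gauss ⊗ bunit : Mor 0 2) cross
    rw [e₁, comp_id] at e₂
    exact (assoc₀₁ S bunit gauss).trans (e₂.trans
      (congrArg (fun x : Mor 0 (n + 2) => x ≫ (𝟙 n ⊗ cross)) (assoc₀₁ S gauss bunit).symm))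
  rw [e, comp_assoc, (pull_cross a b₁ b₂).comp_filter, ← comp_assoc]
  exact (h _).comp ((uses_id n).tensor affine_cross)

theorem filter_const (c : ℝ) : filter (.const c) = const c ≫ wcounit := by
  have e₁ : (𝟙 0 ⊗ zero : Mor 0 1) = zero := empty_tensor zero
  have e₂ : (𝟙 0 ⊗ wcounit : Mor 1 0) = wcounit := empty_tensor wcounit
  rw [filter, e₁, shear, e₂, ← comp_assoc, zero_translate]

/-- A single Gaussian either does not occur in the condition, which then holds or fails outright, or
it is conditioned on its value. -/
theorem canCondition_gauss : CanCondition gauss := by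
  intro a
  obtain ⟨c, b, rfl⟩ : ∃ c b, a = (Functional.const c).snoc b :=
    match a with | .snoc (.const c) b => ⟨c, b, rfl⟩
  have hg : IsSource (𝟙 0 ⊗ gauss : Mor 0 1) := IsSource.nil.gauss
  have e : (𝟙 0 ⊗ gauss : Mor 0 1) = gauss := empty_tensor gauss
  rcases eq_or_ne b 0 with rfl | hb
  · have h := tensor_comp_filter_snoc_zero (𝟙 0) gauss (.const c)
    rw [e, id_comp, filter_const] at h
    have hα : IsScalar (const c ≫ wcounit) := by
      rcases eq_or_ne c 0 with rfl | hc
      · rw [const_zero, white_bone]; exact isScalar_id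
      · exact .inr (const_wcounit hc)
    rw [e] at hg
    have h' : gauss ≫ filter ((Functional.const c).snoc 0) = (const c ≫ wcounit) ≫ gauss ≫ 𝟙 1 :=
      h.trans ((scalar_tensor _ _).trans (congrArg _ (comp_id gauss).symm))
    exact ⟨_, 1, gauss, 𝟙 1, hα, hg, uses_id 1, h'⟩
  · rw [gauss_comp_filter c hb]
    refine ⟨cost (c * -b⁻¹), 0, 𝟙 0, const (c * -b⁻¹), .inl ⟨_, rfl⟩, .nil, affine_const _, ?_⟩
    rw [id_comp]

/-- The source is extended by a Gaussian, so that the induction always meets a Gaussian with which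
another one can be combined. -/
theorem IsSource.canCondition_tensor_gauss {S : Mor 0 n} (hS : IsSource S) :
    CanCondition (S ⊗ Mor.gauss : Mor 0 (n + 1)) := by
  induction hS with
  | nil =>
    have e : (𝟙 0 ⊗ Mor.gauss : Mor 0 1) = Mor.gauss := empty_tensor Mor.gauss
    have h : CanCondition (𝟙 0 ⊗ Mor.gauss : Mor 0 1) := e.symm ▸ canCondition_gauss
    exact h
  | gauss h ih => exact canCondition_tensor_gauss_gauss ih
  | bunit h ih =>
    exact canCondition_tensor_bunit_gauss (canCondition_tensor_bunit (.gauss h) ih)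

/-- The additional Gaussian of `IsSource.canCondition_tensor_gauss` does not occur in the condition,
and is discarded afterwards. -/
theorem IsSource.canCondition {S : Mor 0 n} (hS : IsSource S) : CanCondition S := by
  intro a
  have h := hS.canCondition_tensor_gauss (a.snoc 0)
  rw [tensor_comp_filter_snoc_zero] at h
  have h' := h.comp (A := (𝟙 n ⊗ discard : Mor (n + 1) n)) ((uses_id n).tensor affine_discard)
  have e := interchange (S ≫ filter a) (𝟙 n) Mor.gauss discard
  rw [comp_id, gauss_discard,
    show ((S ≫ filter a) ⊗ 𝟙 0 : Mor 0 n) = _ from tensor_empty (S ≫ filter a)] at e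
  rw [e]
  exact h'

/-- The white counit on the last wire is the conditioning on the corresponding coordinate, followed
by discarding this wire. -/
theorem filter_comp_discard :
    filter ((Functional.zero p).snoc 1) ≫ (𝟙 p ⊗ discard : Mor (p + 1) p) =
      (𝟙 p ⊗ wcounit : Mor (p + 1) p) := by
  have e : (𝟙 1 ⊗ zero : Mor 1 2) ≫ shear₁ 1 ≫ (𝟙 1 ⊗ wcounit : Mor 2 1) ≫ discard = wcounit := by
    rw [← comp_assoc (shear₁ 1), shear₁_wcounit one_ne_zero, ← comp_assoc, ← comp_assoc,
      ← id_tensor_comp, zero_scalar, comp_assoc, ← cap, wcounit_eq]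
  rw [filter, shear, shear_zero, lift_id, id_comp, id_succ_tensor₀₁, id_succ_tensor₁₀, comp_assoc,
    comp_assoc]
  exact (((id_tensor_comp p _ _).trans (congrArg _ ((id_tensor_comp p _ _).trans
    (congrArg _ (id_tensor_comp p _ _))))).symm.trans (congrArg (𝟙 p ⊗ ·) e))

/-- A condition on a normal form is pulled back along the affine part to one on the source. -/
theorem HasNormalForm.comp_wcounit {D : Mor 0 (p + 1)} (hD : HasNormalForm D) :
    HasNormalForm (D ≫ (𝟙 p ⊗ wcounit : Mor (p + 1) p)) := by
  obtain ⟨α, k, S, A, hα, hS, hA, rfl⟩ := hD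
  obtain ⟨a, ha⟩ := hA.hasPullbacks ((Functional.zero p).snoc 1)
  have hd : Uses Gen.IsAffine (𝟙 p ⊗ discard : Mor (p + 1) p) := (uses_id p).tensor affine_discard
  have h := ((hS.canCondition a).comp (hA.comp hd)).scalar_comp hα
  rw [← filter_comp_discard, comp_assoc, comp_assoc, reassoc ha.comp_filter, comp_assoc]
  rw [comp_assoc] at h
  exact h

/-- Composing with `f` preserves normal forms. -/
def Preserves (f : Mor m n) : Prop := ∀ D : Mor 0 m, HasNormalForm D → HasNormalForm (D ≫ f)

theorem Preserves.comp {f : Mor m n} {g : Mor n p} (hf : Preserves f) (hg : Preserves g) :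
    Preserves (f ≫ g) := fun D hD => comp_assoc D f g ▸ hg _ (hf D hD)

theorem Uses.preserves {f : Mor m n} (hf : Uses Gen.IsAffine f) : Preserves f :=
  fun _ hD => hD.comp hf

/-- Further wires to the left of `f` are allowed, as needed for parallel composition; wires to its
right are moved past it with symmetries. -/
theorem isSubprop_preserves :
    IsSubprop (fun {m n} (f : Mor m n) => ∀ p, Preserves (𝟙 p ⊗ f)) where
  id n p := ((uses_id p).tensor (uses_id n)).preserves
  comp hf hg p := by rw [id_tensor_comp]; exact (hf p).comp (hg p)
  cross p := ((uses_id p).tensor affine_cross).preserves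
  tensor := by
    intro m n m' n' f g hf hg p
    have e : f ⊗ 𝟙 m' = swap m m' ≫ (𝟙 m' ⊗ f) ≫ swap m' n := by
      rw [← comp_assoc, ← swap_natural, comp_assoc, swap_swap, comp_id]
    have h (x y : ℕ) : Preserves (𝟙 p ⊗ swap x y) := ((uses_id p).tensor (uses_swap x y)).preserves
    rw [← slide f g, e, id_tensor_comp, id_tensor_comp, id_tensor_comp, ← tensor_assoc,
      ← tensor_assoc, id_tensor_id, id_tensor_id]
    exact ((h m m').comp ((cast_mem (P := Preserves) (hf (p + m')) _ _).comp (h m' n))).comp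
      (cast_mem (P := Preserves) (hg (p + n)) _ _)

/-- It suffices to consider the generators. Among them, `bmul` and `wcomul` are composites of the
others. -/
theorem preserves_mk (t : Diagram m n) (p : ℕ) : Preserves (𝟙 p ⊗ mk t) := by
  have hP := isSubprop_preserves
  have haff {m n : ℕ} {f : Mor m n} (hf : Uses Gen.IsAffine f) (p : ℕ) : Preserves (𝟙 p ⊗ f) :=
    ((uses_id p).tensor hf).preserves
  have hbunit (p : ℕ) : Preserves (𝟙 p ⊗ bunit) := fun D hD => by
    have e : D ≫ (𝟙 p ⊗ bunit : Mor p (p + 1)) = (D ⊗ bunit : Mor 0 (p + 1)) :=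
      (tensor_source D bunit).symm
    exact e ▸ hD.tensor .bunit
  have hgauss (p : ℕ) : Preserves (𝟙 p ⊗ gauss) := fun D hD => by
    have e : D ≫ (𝟙 p ⊗ gauss : Mor p (p + 1)) = (D ⊗ gauss : Mor 0 (p + 1)) :=
      (tensor_source D gauss).symm
    exact e ▸ hD.tensor .gauss
  have hwcounit (p : ℕ) : Preserves (𝟙 p ⊗ wcounit) := fun D hD => hD.comp_wcounit
  -- `cap` has to be expressed by the white structure, since `bmul` is treated only below.
  have hcap : ∀ p, Preserves (𝟙 p ⊗ cap) := by
    have e : cap = (𝟙 1 ⊗ scalar (-1)) ≫ add ≫ wcounit := by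
      rw [white_cap, ← comp_assoc, ← id_tensor_comp, scalar_mul, neg_mul_neg, one_mul, scalar_one,
        id_tensor_id, id_comp]
    rw [e]
    exact hP.comp (haff ((uses_id 1).tensor (affine_scalar _)))
      (hP.comp (haff affine_add) hwcounit)
  induction t generalizing p with
  | id n => exact hP.id n p
  | swap m n => exact haff (uses_swap m n) p
  | comp f g hf hg => exact hP.comp hf hg p
  | tensor f g hf hg => exact hP.tensor hf hg p
  | gen s =>
    cases s with
    | copy => exact haff affine_copy p
    | discard => exact haff affine_discard p
    | add => exact haff affine_add p
    | zero => exact haff affine_zero p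
    | scalar k => exact haff (affine_scalar k) p
    | one => exact haff affine_one p
    | gauss => exact hgauss p
    | bunit => exact hbunit p
    | wcounit => exact hwcounit p
    | bmul =>
      have h := hP.comp (hP.tensor (f := copy) (g := 𝟙 1) (haff affine_copy) (hP.id 1))
        (hP.tensor (f := 𝟙 1) (g := cap) (hP.id 1) hcap) p
      rw [← bmul_eq] at h
      exact h
    | wcomul =>
      have h₁ : ∀ p, Preserves (𝟙 p ⊗ cocap) :=
        hP.comp (hP.comp hbunit (haff affine_copy)) (haff ((uses_id 1).tensor (affine_scalar _)))
      have h := hP.comp (hP.tensor (f := 𝟙 1) (g := cocap) (hP.id 1) h₁)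
        (hP.tensor (f := add) (g := 𝟙 1) (haff affine_add) (hP.id 1)) p
      have e : (𝟙 1 ⊗ cocap) ≫ (add ⊗ 𝟙 1) = wcomul := wcomul_eq.symm
      rw [e] at h
      exact h

theorem hasNormalForm_mk (M : Diagram 0 n) : HasNormalForm (mk M) := by
  have h := cast_mem (P := Preserves) (preserves_mk M 0) (Nat.zero_add 0) (Nat.zero_add n)
  rw [empty_tensor] at h
  rw [← id_comp (mk M)]
  refine h _ ⟨𝟙 0, 0, 𝟙 0, 𝟙 0, isScalar_id, .nil, uses_id 0, ?_⟩
  rw [id_comp, id_comp]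

theorem Uses.mono {P Q : ∀ ⦃m n : ℕ⦄, Gen m n → Prop} (h : ∀ ⦃m n : ℕ⦄ (s : Gen m n), P s → Q s)
    {f : Mor m n} (hf : Uses P f) : Uses Q f := by
  obtain ⟨t, ht, rfl⟩ := hf
  refine ⟨t, ?_, rfl⟩
  induction t with
  | gen s => exact h s ht
  | id => trivial
  | swap => trivial
  | comp f g hf hg => exact ⟨hf ht.1, hg ht.2⟩
  | tensor f g hf hg => exact ⟨hf ht.1, hg ht.2⟩

theorem IsSource.uses {S : Mor 0 n} (hS : IsSource S) : Uses Gen.IsCausalE S := by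
  induction hS with
  | nil => exact uses_id 0
  | gauss _ ih => exact ih.tensor (.gen (s := .gauss) trivial)
  | bunit _ ih => exact ih.tensor (.gen (s := .bunit) trivial)

theorem IsScalar.exists_diagram {α : Mor 0 0} (h : IsScalar α) :
    ∃ a : Diagram 0 0, a.IsNormalScalar ∧ mk a = α := by
  rcases h with ⟨c, rfl⟩ | rfl
  · exact ⟨Diagram.cost |c|, .inl ⟨|c|, abs_nonneg c, rfl⟩, (cost_abs c).symm⟩
  · exact ⟨Diagram.infinity, .inr rfl, rfl⟩

end Mor

end GQA

open GQA Mor in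
theorem mainTheorem3 (n : ℕ) (M : GQA.Diagram 0 n) :
    ∃ (M' : GQA.Diagram 0 n) (α : GQA.Diagram 0 0),
      M'.InCausalE ∧ α.IsNormalScalar ∧ GQA.Provable M (M' ⊕ₚ α) := by
  obtain ⟨α, k, S, A, hα, hS, hA, e⟩ := hasNormalForm_mk M
  obtain ⟨a, ha, rfl⟩ := hα.exists_diagram
  obtain ⟨t, ht, e'⟩ := hS.uses.comp (hA.mono (Q := Gen.IsCausalE) (by
    intro m n s hs; cases s <;> trivial))
  refine ⟨t, a, ht, ha, mk_eq_iff.1 (e.trans ?_)⟩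
  rw [← e', mk_tensor]
  have h := slide' (mk t) (mk a)
  rw [show (𝟙 0 ⊗ mk a : Mor 0 0) = mk a from empty_tensor (mk a),
    show (mk t ⊗ 𝟙 0 : Mor 0 n) = mk t from tensor_empty (mk t)] at h
  exact h
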